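/- Let $1<R<\infty$ with $\log R\le 3/2$, and let $A(1,R)=\{z\in\mathbb C:1<|z|<R\}$. Let $\mathcal A\subset\mathbb C$ be a doubly connected domain whose complement in the Riemann sphere $\widehat{\mathbb C}$ is the disjoint union of the closed unit disk $\{|w|\le 1\}$ (the inner component) and a closed connected set containing $\infty$ (the outer component). Let $h$ be an orientation-preserving harmonic homeomorphism of $A(1,R)$ onto $\mathcal A$ which takes the inner boundary to the inner boundary, in the sense that the cluster set of $h$ at the circle $|z|=1$ is the unit circle. Then the limit $$R_*(h)=\lim_{\rho\nearrow R}\Big(\frac1{2\pi}\int_0^{2\pi}|h(\rho e^{i\theta})|^2\,d\theta\Big)^{1/2}$$ exists in $[0,+\infty]$, and $$R_*(h)\ \ge\ \frac12\Big(R+\frac1R\Big).$$ -/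

import Mathlib

open Set Filter Topology

/-- The open round annulus `A(1, R) = {z : 1 < |z| < R}`. -/
def roundAnnulus (R : ℝ) : Set ℂ := {z : ℂ | 1 < ‖z‖ ∧ ‖z‖ < R}

/-- A half round annulus: a doubly connected plane domain `D` whose complement in the Riemann sphere
is the disjoint union of the closed unit disk (the inner component) and a closed connected set that
contains `∞` (the outer component). -/
structure IsHalfRoundAnnulus (D : Set ℂ) : Prop where
  isOpen : IsOpen D
  isConnected : IsConnected D
  compl_eq : ∃ G : Set (OnePoint ℂ), IsClosed G ∧ IsConnected G ∧ OnePoint.infty ∈ G ∧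
    Disjoint ((fun z : ℂ => (z : OnePoint ℂ)) '' Metric.closedBall 0 1) G ∧
    ((fun z : ℂ => (z : OnePoint ℂ)) '' D)ᶜ =
      (fun z : ℂ => (z : OnePoint ℂ)) '' Metric.closedBall 0 1 ∪ G

/-- The closed curve `γ : [0, 2π] → ℂ` avoids `0` and has winding number `n` about `0`:
the increment of a continuous branch of the argument along `γ` is `2πn`. -/
def HasWindingNumber (γ : ℝ → ℂ) (n : ℤ) : Prop :=
  (∀ t ∈ Icc 0 (2 * Real.pi), γ t ≠ 0) ∧
    ∃ φ : ℝ → ℝ, ContinuousOn φ (Icc 0 (2 * Real.pi)) ∧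
      (∀ t ∈ Icc 0 (2 * Real.pi), γ t = (‖γ t‖ : ℂ) * Complex.exp ((φ t : ℂ) * Complex.I)) ∧
      φ (2 * Real.pi) - φ 0 = 2 * Real.pi * (n : ℝ)

/-- A map that is injective and continuous on the open set `U` is orientation preserving if its
local degree at each point `z` of `U` is `1`: the image of each sufficiently small positively
oriented circle about `z` has winding number `1` about the image of `z`. -/
def IsOrientationPreservingOn (h : ℂ → ℂ) (U : Set ℂ) : Prop :=
  ∀ z ∈ U, ∀ᶠ r in 𝓝[>] (0 : ℝ), HasWindingNumber (fun t : ℝ => h (circleMap z r t) - h z) 1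

/-- The cluster set, in the Riemann sphere, of a map `h` of `A(1, R)` at the inner circle `|z| = 1`:
all limits of sequences `h (zₖ)` with `|zₖ| > 1` and `|zₖ| → 1`. -/
def innerClusterSet (h : ℂ → ℂ) : Set (OnePoint ℂ) :=
  {w | MapClusterPt w (comap (fun z : ℂ => ‖z‖) (𝓝[>] 1)) (fun z => (h z : OnePoint ℂ))}

/-- The class of orientation preserving harmonic homeomorphisms of `A(1, R)` onto `D` whose cluster
set at the inner circle is the unit circle (the inner boundary of `D`, when `D` is a half round
annulus). Only the values of `h` on `A(1, R)` matter. -/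
structure IsHarmonicHomeo (R : ℝ) (D : Set ℂ) (h : ℂ → ℂ) : Prop where
  isEmbedding : IsEmbedding ((roundAnnulus R).domRestrict h)
  image_eq : h '' roundAnnulus R = D
  orientation : IsOrientationPreservingOn h (roundAnnulus R)
  harmonic : InnerProductSpace.HarmonicOnNhd h (roundAnnulus R)
  innerClusterSet_eq :
    innerClusterSet h = (fun z : ℂ => (z : OnePoint ℂ)) '' Metric.sphere 0 1

/-- `L ∈ [0, ∞]` is the mean outer radius of `h`: the limit, as `ρ ↗ R`, of the square root of the
average of `|h|²` over the circle `|z| = ρ`. -/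
def HasMeanOuterRadius (R : ℝ) (h : ℂ → ℂ) (L : ENNReal) : Prop :=
  Tendsto (fun ρ : ℝ => ENNReal.ofReal (Real.sqrt (Real.circleAverage (fun z => ‖h z‖ ^ 2) 0 ρ)))
    (𝓝[<] R) (𝓝 L)

/-! Put `H t θ = h (exp (t + iθ))`, a harmonic function on a strip, periodic in `θ`, with Fourier
modes `c n t`. Three means control it: `M = Σ |c n|²`, the mean of `|H|²`; `A = Σ n |c n|²`, the
mean of `Im (conj H * Hθ)`; and `B = Σ Re (conj (c n) * (c n)')`, which is `M' / 2`. Since `(c n)''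
= n² c n`, each mode at time `ε` determines its value at time `t = ε + τ`.

The core is an inequality for a single mode (`mode_bound`): for a constant `k = modeSlope τ ≥ 0`,
`|c n t|²` is at least `(cosh² τ - k + k n) |c n ε|² + 2 sinh τ cosh τ Re (conj (c n ε) * (c n)'
ε)`. Summing over `n` gives `M t ≥ (cosh² τ - k) M ε + k A ε + 2 sinh τ cosh τ B ε` (`le_mean_sq`).
Now `M ε → 1` as `ε → 0`, while `A ≥ 1` and `B ≥ 0`, so `M t ≥ cosh² t`; and `cosh (log ρ) = (ρ +
1/ρ) / 2`. The bound `log R ≤ 3/2` enters only through an estimate for `k`.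

`B ≥ 0` holds because `B` increases and `M` starts at its minimum `1` (`mean_t_nonneg`). `A ≥ 1` is
an area statement (`one_le_mean_area`): each image curve winds at least once around the unit disk.
No boundary values of `h` exist a priori, so Green's formula is used with weights that vanish near
the unit circle. It needs the Jacobian to be nonnegative (orientation) and not identically zero on
any open set (Sard and openness of `h`). -/

/-! ### Hyperbolic inequalities. -/

/-- This is subadditivity of `tanh`, `tanh (nτ) ≤ n tanh τ`, with denominators cleared. -/
theorem sinh_mul_cosh_le_mul_cosh_mul_sinh {n : ℕ} (hn : 1 ≤ n) {τ : ℝ} (hτ : 0 ≤ τ) :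
    Real.sinh (n * τ) * Real.cosh τ ≤ n * (Real.cosh (n * τ) * Real.sinh τ) := by
  induction n, hn using Nat.le_induction with
  | base => simp [mul_comm]
  | succ n hn ih =>
    have e : ((n + 1 : ℕ) : ℝ) * τ = n * τ + τ := by push_cast; ring
    rw [e, Real.sinh_add, Real.cosh_add]
    have h1 : 0 ≤ Real.sinh (n * τ) := Real.sinh_nonneg_iff.2 (by positivity)
    have h2 : 0 < Real.cosh τ := Real.cosh_pos τ
    have h4 : 0 ≤ ((n : ℝ) + 1) * (Real.sinh (n * τ) * Real.sinh τ ^ 2) := by positivity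
    have h5 := mul_le_mul_of_nonneg_right ih h2.le
    push_cast
    nlinarith [Real.cosh_sq τ]

theorem mul_sinh_mul_cosh_le_sinh {n : ℕ} (hn : 2 ≤ n) {τ : ℝ} (hτ : 0 ≤ τ) :
    n * (Real.sinh τ * Real.cosh τ) ≤ Real.sinh (n * τ) := by
  induction n, hn using Nat.le_induction with
  | base => push_cast; rw [Real.sinh_two_mul]; linarith
  | succ n hn ih =>
    have e : ((n + 1 : ℕ) : ℝ) * τ = n * τ + τ := by push_cast; ring
    rw [e, Real.sinh_add]
    have h1 : 0 ≤ Real.sinh τ := Real.sinh_nonneg_iff.2 hτ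
    have h2 : 1 ≤ Real.cosh τ := Real.one_le_cosh τ
    have hn' : (1 : ℝ) ≤ n := by exact_mod_cast (by omega : 1 ≤ n)
    have h3 : Real.cosh τ ≤ Real.cosh (n * τ) := by
      rw [Real.cosh_le_cosh, abs_of_nonneg hτ, abs_of_nonneg (by positivity)]
      nlinarith
    have h4 : 0 ≤ n * (Real.sinh τ * Real.cosh τ) := by positivity
    push_cast
    nlinarith [mul_le_mul_of_nonneg_right h3 h1, mul_le_mul_of_nonneg_right ih (by linarith : 0 ≤ Real.cosh τ)]

theorem cosh_sq_add_mul_sinh_sq_le {n : ℕ} (hn : 1 ≤ n) {τ : ℝ} (hτ : 0 ≤ τ) :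
    Real.sinh (n * τ) * (Real.cosh τ ^ 2 + (n - 1) * Real.sinh τ ^ 2) ≤
      n * (Real.cosh (n * τ) * (Real.sinh τ * Real.cosh τ)) := by
  induction n, hn using Nat.le_induction with
  | base => simp; nlinarith
  | succ n hn ih =>
    have e : ((n + 1 : ℕ) : ℝ) * τ = n * τ + τ := by push_cast; ring
    have key := sinh_mul_cosh_le_mul_cosh_mul_sinh hn hτ
    have h2 : 0 < Real.cosh τ := Real.cosh_pos τ
    rw [e, Real.sinh_add, Real.cosh_add]
    push_cast
    have h1 := Real.cosh_sq τ
    -- The gap at `n + 1` is exactly the gap in `tanh (nτ) ≤ n tanh τ`, so the induction hypothesis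
    -- is not needed.
    have : (↑n + 1) * ((Real.cosh (n * τ) * Real.cosh τ + Real.sinh (n * τ) * Real.sinh τ) *
        (Real.sinh τ * Real.cosh τ)) - (Real.sinh (n * τ) * Real.cosh τ + Real.cosh (n * τ) * Real.sinh τ) *
          (Real.cosh τ ^ 2 + (↑n + 1 - 1) * Real.sinh τ ^ 2) =
        (Real.cosh τ ^ 2 - Real.sinh τ ^ 2) * (n * (Real.cosh (n * τ) * Real.sinh τ) - Real.sinh (n * τ) * Real.cosh τ) := by ring
    rw [Real.cosh_sq_sub_sinh_sq] at this
    linarith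

theorem sinh_mul_cosh_sub_le {τ : ℝ} (h0 : 0 < τ) (h1 : τ ≤ 1) :
    Real.sinh τ * Real.cosh τ - τ ≤ τ * Real.sinh τ := by
  have ha : |τ| ≤ 1 := by rw [abs_of_pos h0]; exact h1
  have a1 := abs_le.1 (Real.exp_bound ha (n := 4) (by norm_num))
  have a2 := abs_le.1 (Real.exp_bound (x := -τ) (by simpa using ha) (n := 4) (by norm_num))
  simp only [Finset.sum_range_succ, Finset.sum_range_zero, abs_neg, abs_of_pos h0] at a1 a2
  norm_num [Nat.factorial] at a1 a2
  -- Taylor polynomials of degree 3 with remainder `5 τ⁴ / 96`; higher powers are absorbed using `τ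
  -- ≤ 1`, so `53/96 = 1/2 + 5/96` and, for `sinh`, `7/32 = 1/6 + 5/96`.
  have hC : Real.cosh τ ≤ 1 + (53 / 96) * τ ^ 2 := by
    rw [Real.cosh_eq]
    nlinarith [sq_nonneg τ, mul_nonneg (sq_nonneg τ) (by nlinarith : 0 ≤ 1 - τ ^ 2)]
  have hS : Real.sinh τ ≤ τ * (1 + (7 / 32) * τ ^ 2) := by
    rw [Real.sinh_eq]
    nlinarith [mul_nonneg (pow_pos h0 3).le (by linarith : 0 ≤ 1 - τ)]
  have hS0 : 0 < Real.sinh τ := Real.sinh_pos_iff.2 h0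
  have : Real.sinh τ * (Real.cosh τ - τ) ≤ τ := by
    have hx : 0 ≤ 1 + 53 / 96 * τ ^ 2 - τ := by nlinarith [sq_nonneg (τ - 1)]
    calc Real.sinh τ * (Real.cosh τ - τ) ≤ Real.sinh τ * (1 + 53 / 96 * τ ^ 2 - τ) := by
          gcongr
      _ ≤ τ * (1 + (7 / 32) * τ ^ 2) * (1 + 53 / 96 * τ ^ 2 - τ) := by gcongr
      _ ≤ τ * 1 := by
          rw [mul_assoc]
          gcongr
          nlinarith [mul_nonneg h0.le (by linarith : 0 ≤ 1 - τ), mul_nonneg (mul_nonneg h0.le h0.le) (by linarith : 0 ≤ 1 - τ), pow_pos h0 3, mul_nonneg (pow_pos h0 3).le (by linarith : 0 ≤ 1 - τ)]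
      _ = τ := mul_one τ
  linarith

theorem exp_le_chord {a b x : ℝ} (ha : a ≤ x) (hb : x ≤ b) (hab : a < b) :
    (b - a) * Real.exp x ≤ (b - x) * Real.exp a + (x - a) * Real.exp b := by
  have := convexOn_exp.2 (mem_univ a) (mem_univ b)
    (div_nonneg (sub_nonneg.2 hb) (sub_nonneg.2 hab.le))
    (div_nonneg (sub_nonneg.2 ha) (sub_nonneg.2 hab.le))
    (by have := (sub_pos.2 hab).ne'; field_simp; ring)
  have hne := (sub_pos.2 hab).ne'
  simp only [smul_eq_mul] at this
  have e : (b - x) / (b - a) * a + (x - a) / (b - a) * b = x := by field_simp; ring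
  rw [e] at this
  have h2 := mul_le_mul_of_nonneg_left this (sub_pos.2 hab).le
  calc _ ≤ _ := h2
    _ = _ := by field_simp

/-- With `u = 2τ`, `s = sinh u` and `w = exp (-u)`, the claim becomes `s² - (2u + u²/2) s + u² (1 +
w) / 2 ≤ 0` for `2 ≤ u ≤ 3`. Convexity of `exp` bounds `s` and `w` above by the affine functions `P`
and `m` of `u`, which leaves a polynomial inequality. -/
theorem sinh_sq_add_sq_le {τ : ℝ} (h0 : 1 ≤ τ) (h1 : τ ≤ 3 / 2) :
    Real.sinh τ ^ 2 + (Real.sinh τ * Real.cosh τ / τ - 1) ^ 2 ≤ 2 * (Real.sinh τ * Real.cosh τ) := by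
  have e1 := Real.exp_one_gt_d9
  have e2 := Real.exp_one_lt_d9
  have E2 : Real.exp 2 = Real.exp 1 ^ 2 := by rw [← Real.exp_nat_mul]; norm_num
  have E3 : Real.exp 3 = Real.exp 1 ^ 3 := by rw [← Real.exp_nat_mul]; norm_num
  obtain ⟨u, hu⟩ : ∃ u, u = 2 * τ := ⟨_, rfl⟩
  have hu2 : 2 ≤ u := by linarith
  have hu3 : u ≤ 3 := by linarith
  have b1 := exp_le_chord hu2 hu3 (by norm_num)
  have b2 := exp_le_chord (a := -3) (b := -2) (x := -u) (by linarith) (by linarith) (by norm_num)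
  have x2l : 7.38905 ≤ Real.exp 2 := by rw [E2]; nlinarith
  have x2u : Real.exp 2 ≤ 7.38907 := by rw [E2]; nlinarith
  have x3l : 20.0855 ≤ Real.exp 3 := by
    rw [E3]; calc (20.0855:ℝ) ≤ 2.7182818283 ^ 3 := by norm_num
      _ ≤ _ := by gcongr
  have x3u : Real.exp 3 ≤ 20.0856 := by
    rw [E3]; calc Real.exp 1 ^ 3 ≤ 2.7182818286 ^ 3 := by gcongr
      _ ≤ _ := by norm_num
  have m2 : Real.exp (-2) ≤ 0.13534 := by
    rw [Real.exp_neg, inv_le_comm₀ (Real.exp_pos 2) (by norm_num)]; norm_num; linarith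
  have m3 : Real.exp (-3) ≤ 0.04979 := by
    rw [Real.exp_neg, inv_le_comm₀ (Real.exp_pos 3) (by norm_num)]; norm_num; linarith
  have m3l : 0.04978 ≤ Real.exp (-3) := by
    rw [Real.exp_neg, le_inv_comm₀ (by norm_num) (Real.exp_pos 3)]; norm_num; linarith
  have m2l : 0.1353 ≤ Real.exp (-2) := by
    rw [Real.exp_neg, le_inv_comm₀ (by norm_num) (Real.exp_pos 2)]; norm_num; linarith
  -- The tangent to `exp (-u)` at `u = 3`: the upper bound for `sinh u` needs a lower bound for `exp
  -- (-u)`.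
  have m1 : 0.04978 * (4 - u) ≤ Real.exp (-u) := by
    have h := Real.add_one_le_exp (3 - u)
    have h' : Real.exp (-u) = Real.exp (-3) * Real.exp (3 - u) := by rw [← Real.exp_add]; ring_nf
    rw [h']
    have : 0 ≤ 4 - u := by linarith
    calc _ ≤ Real.exp (-3) * (4 - u) := by gcongr
      _ ≤ _ := by gcongr; linarith
  have hS : Real.sinh τ * Real.cosh τ = Real.sinh u / 2 := by rw [hu, Real.sinh_two_mul]; ring
  have hC : Real.sinh τ ^ 2 = (Real.sinh u + Real.exp (-u) - 1) / 2 := by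
    have h1 := Real.cosh_two_mul τ
    have h2 := Real.cosh_sq τ
    rw [← hu] at h1
    have h3 : Real.cosh u = Real.sinh u + Real.exp (-u) := by
      rw [Real.cosh_eq, Real.sinh_eq]; ring
    linarith
  obtain ⟨P, hP⟩ : ∃ P, P = ((3 - u) * 7.38907 + (u - 2) * 20.0856 - 0.04978 * (4 - u)) / 2 := ⟨_, rfl⟩
  obtain ⟨m, hm⟩ : ∃ m, m = (3 - u) * 0.13534 + (u - 2) * 0.04979 := ⟨_, rfl⟩
  have hsP : Real.sinh u ≤ P := by
    rw [Real.sinh_eq, hP]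
    have : (3 - u) * Real.exp 2 + (u - 2) * Real.exp 3 ≤ (3 - u) * 7.38907 + (u - 2) * 20.0856 := by
      gcongr
    linarith
  have hsm : 3.6 ≤ Real.sinh u := by
    have h1 : Real.sinh 2 ≤ Real.sinh u := Real.sinh_le_sinh.2 hu2
    rw [Real.sinh_eq 2] at h1
    linarith
  have hmm : Real.exp (-u) ≤ m := by
    have : (-2 - -u) * Real.exp (-3) + (-u - -3) * Real.exp (-2) ≤ (3 - u) * 0.13534 + (u - 2) * 0.04979 := by
      nlinarith
    linarith
  generalize Real.exp (-u) = w at *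
  generalize Real.sinh u = s at *
  have hQP : P ^ 2 - (2 * u + u ^ 2 / 2) * P + u ^ 2 * (1 + m) / 2 ≤ 0 := by
    rw [hP, hm]
    obtain ⟨x, hx⟩ : ∃ x, x = u - 2 := ⟨_, rfl⟩
    have hx0 : 0 ≤ x := by linarith
    have hx1 : 0 ≤ 1 - x := by linarith
    obtain rfl : u = x + 2 := by linarith
    nlinarith [mul_nonneg hx0 hx1, mul_nonneg (mul_nonneg hx0 hx1) hx0, mul_nonneg (mul_nonneg hx0 hx1) hx1]
  have hQ : s ^ 2 - (2 * u + u ^ 2 / 2) * s + u ^ 2 * (1 + w) / 2 ≤ 0 := by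
    -- The quadratic at `P` minus the quadratic at `s` is `(P - s) (P + s - 2u - u²/2)`; with `s ≥
    -- 3.6` the second factor is nonnegative, so `P` may replace `s`.
    have h1 : 0 ≤ 3.6 + P - 2 * u - u ^ 2 / 2 := by rw [hP]; nlinarith
    have h2 := mul_nonneg h1 (sub_nonneg.2 hsP)
    have h3 := mul_nonneg (sub_nonneg.2 hsm) (sub_nonneg.2 hsP)
    have h4 := mul_nonneg (sq_nonneg u) (sub_nonneg.2 hmm)
    nlinarith
  rw [hC, hS]
  have hτ : τ = u / 2 := by linarith
  have hu0 : 0 < u := by linarith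
  have : (s + w - 1) / 2 + (s / 2 / τ - 1) ^ 2 - 2 * (s / 2) =
      (s ^ 2 - (2 * u + u ^ 2 / 2) * s + u ^ 2 * (1 + w) / 2) / u ^ 2 := by
    rw [hτ]; field_simp; ring
  have h5 := div_nonpos_of_nonpos_of_nonneg hQ (sq_nonneg u)
  linarith

/-! ### The inequality for a single Fourier mode. -/

/-- The coefficient `k` for which every mode lies above a chord. -/
noncomputable def modeSlope (τ : ℝ) : ℝ :=
  Real.sinh τ ^ 2 + (Real.sinh τ * Real.cosh τ / τ - 1) ^ 2

theorem modeSlope_nonneg (τ : ℝ) : 0 ≤ modeSlope τ := by unfold modeSlope; positivity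

/-- The solution of `y'' = n² y`, `y 0 = 0`, `y' 0 = 1`. -/
noncomputable def modeSinh (n : ℤ) (τ : ℝ) : ℝ := if n = 0 then τ else Real.sinh (n * τ) / n

/-- Expand `‖p c + q y‖² - ‖p x + q y‖²`: the `‖q‖²` terms cancel and the cross term has coefficient
`2 (c - x) y = 2 s`. Thus `x` is chosen to give the same cross coefficient `2 s` for every mode. -/
theorem add_mul_re_le_normSq {p q : ℂ} {c y x s : ℝ} (h : c * y - s = x * y) :
    ‖p‖ ^ 2 * (c ^ 2 - x ^ 2) + 2 * s * ((starRingEnd ℂ) p * q).re ≤ ‖p * c + q * y‖ ^ 2 := by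
  have h0 := sq_nonneg ‖p * x + q * y‖
  simp only [Complex.sq_norm, Complex.normSq_apply, Complex.add_re, Complex.add_im, Complex.mul_re,
    Complex.mul_im, Complex.ofReal_re, Complex.ofReal_im, Complex.conj_re, Complex.conj_im] at *
  have h1 : s = c * y - x * y := by linarith
  subst h1
  nlinarith

theorem chord_le_of_one_le {n : ℕ} (hn : 1 ≤ n) {τ : ℝ} (h0 : 0 < τ) (h1 : τ ≤ 3 / 2) :
    ∃ x, Real.cosh (n * τ) * (Real.sinh (n * τ) / n) - Real.sinh τ * Real.cosh τ =
        x * (Real.sinh (n * τ) / n) ∧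
      Real.cosh τ ^ 2 + modeSlope τ * (n - 1) ≤ Real.cosh (n * τ) ^ 2 - x ^ 2 := by
  have hn0 : (0 : ℝ) < n := by exact_mod_cast hn
  have hSn : 0 < Real.sinh (n * τ) := Real.sinh_pos_iff.2 (by positivity)
  have hS : 0 < Real.sinh τ := Real.sinh_pos_iff.2 h0
  have hC : 1 ≤ Real.cosh τ := Real.one_le_cosh τ
  -- With `x = cosh (nτ) - r` the lower bound is `2 r cosh (nτ) - r²`. For `n = 1` one gets `x = 0`
  -- and equality; for `n ≥ 2`, `r ≤ 1` allows `r²` to be replaced by `1`.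
  obtain ⟨r, hr⟩ : ∃ r, r = Real.sinh τ * Real.cosh τ * n / Real.sinh (n * τ) := ⟨_, rfl⟩
  refine ⟨Real.cosh (n * τ) - r, ?_, ?_⟩
  · rw [hr]; field_simp
  have hCS := Real.cosh_sq τ
  rcases hn.eq_or_lt with rfl | hn2
  · simp only [Nat.cast_one, one_mul, mul_one, sub_self, mul_zero, add_zero] at *
    have : r = Real.cosh τ := by rw [hr]; field_simp
    rw [this]; simp
  have hr0 : 0 ≤ r := by rw [hr]; positivity
  have hr1 : r ≤ 1 := by
    rw [hr, div_le_one hSn]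
    linarith [mul_sinh_mul_cosh_le_sinh hn2 h0.le]
  have hn1 : (1 : ℝ) ≤ n - 1 := by
    have : (2 : ℝ) ≤ n := by exact_mod_cast hn2
    linarith
  have main : Real.cosh τ ^ 2 + modeSlope τ * (n - 1) ≤ 2 * (r * Real.cosh (n * τ)) - 1 := by
    -- For `τ ≤ 1` the slope is at most `2 sinh² τ`; beyond that the weaker bound `2 sinh τ cosh τ`
    -- is used, with `cosh (nτ) ≥ sinh (nτ)`.
    rcases le_total τ 1 with hτ | hτ
    · have hk : modeSlope τ ≤ 2 * Real.sinh τ ^ 2 := by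
        have h2 := sinh_mul_cosh_sub_le h0 hτ
        have h3 : Real.sinh τ * Real.cosh τ / τ - 1 ≤ Real.sinh τ := by
          rw [sub_le_iff_le_add, div_le_iff₀ h0]; linarith
        have h4 : 0 ≤ Real.sinh τ * Real.cosh τ / τ - 1 := by
          rw [sub_nonneg, one_le_div h0]
          have : τ < Real.sinh τ := Real.self_lt_sinh_iff.2 h0
          nlinarith
        unfold modeSlope; nlinarith
      have h5 : Real.cosh τ ^ 2 + (n - 1) * Real.sinh τ ^ 2 ≤ r * Real.cosh (n * τ) := by
        rw [hr, div_mul_eq_mul_div, le_div_iff₀ hSn]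
        linarith [cosh_sq_add_mul_sinh_sq_le hn h0.le]
      nlinarith [mul_le_mul_of_nonneg_right hk (by linarith : (0 : ℝ) ≤ n - 1)]
    · have hk : modeSlope τ ≤ 2 * (Real.sinh τ * Real.cosh τ) := sinh_sq_add_sq_le hτ h1
      have h5 : Real.sinh τ * Real.cosh τ * n ≤ r * Real.cosh (n * τ) := by
        rw [hr, div_mul_eq_mul_div, le_div_iff₀ hSn]
        gcongr
        exact (Real.sinh_lt_cosh _).le
      have h6 : 1 + Real.cosh τ ^ 2 ≤ 2 * (Real.sinh τ * Real.cosh τ) := by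
        have h7 : Real.sinh 1 ≤ Real.sinh τ := Real.sinh_le_sinh.2 hτ
        have e1 := Real.exp_one_gt_d9
        have h8 : 1.17 ≤ Real.sinh 1 := by
          rw [Real.sinh_eq, Real.exp_neg]
          have : (Real.exp 1)⁻¹ ≤ 0.37 := by
            rw [inv_le_comm₀ (by positivity) (by norm_num)]; linarith
          linarith
        have h9 : 1.17 ≤ Real.sinh τ := h8.trans h7
        -- After squaring this is `sinh² τ ≥ 9/7`, and `1.17² > 9/7`.
        have h10 : 3 / 2 * Real.cosh τ ≤ 2 * Real.sinh τ := by
          exact (pow_le_pow_iff_left₀ (by positivity) (by linarith) two_ne_zero).1 (by nlinarith)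
        nlinarith
      nlinarith [mul_le_mul_of_nonneg_right hk (by linarith : (0 : ℝ) ≤ n - 1)]
  nlinarith

theorem mode_bound {τ : ℝ} (h0 : 0 < τ) (h1 : τ ≤ 3 / 2) (n : ℤ) (p q : ℂ) :
    (Real.cosh τ ^ 2 - modeSlope τ) * ‖p‖ ^ 2 + modeSlope τ * (n * ‖p‖ ^ 2) +
        2 * (Real.sinh τ * Real.cosh τ) * ((starRingEnd ℂ) p * q).re ≤
      ‖p * Real.cosh (n * τ) + q * modeSinh n τ‖ ^ 2 := by
  suffices ∃ x, Real.cosh (n * τ) * modeSinh n τ - Real.sinh τ * Real.cosh τ = x * modeSinh n τ ∧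
      Real.cosh τ ^ 2 + modeSlope τ * (n - 1) ≤ Real.cosh (n * τ) ^ 2 - x ^ 2 by
    obtain ⟨x, hx, hx'⟩ := this
    have := add_mul_re_le_normSq (p := p) (q := q) hx
    nlinarith [mul_le_mul_of_nonneg_left hx' (sq_nonneg ‖p‖)]
  rcases eq_or_ne n 0 with rfl | hn
  -- The mode `n = 0` is the binding case: here the bound is an equality, and this fixes the value
  -- of `modeSlope`.
  · refine ⟨1 - Real.sinh τ * Real.cosh τ / τ, ?_, ?_⟩
    · simp [modeSinh]; field_simp
    · have := Real.cosh_sq τ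
      simp [modeSlope]; nlinarith
  · have hn1 : 1 ≤ n.natAbs := by omega
    obtain ⟨x, hx, hx'⟩ := chord_le_of_one_le hn1 h0 h1
    have hab : ((n.natAbs : ℕ) : ℝ) = |(n : ℝ)| := by simp [Nat.cast_natAbs]
    rw [hab] at hx hx'
    have e1 : Real.cosh (|(n : ℝ)| * τ) = Real.cosh (n * τ) := by
      rcases abs_choice (n : ℝ) with h | h <;> rw [h]; rw [neg_mul, Real.cosh_neg]
    have e2 : Real.sinh (|(n : ℝ)| * τ) / |(n : ℝ)| = modeSinh n τ := by
      rw [modeSinh, if_neg hn]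
      rcases abs_choice (n : ℝ) with h | h <;> rw [h]; rw [neg_mul, Real.sinh_neg, neg_div_neg_eq]
    rw [e1, e2] at hx
    rw [e1] at hx'
    -- Negative `n` reduces to `|n|`, since `n ≤ |n|` and the slope is nonnegative.
    refine ⟨x, hx, le_trans ?_ hx'⟩
    have := mul_le_mul_of_nonneg_left (le_abs_self (n : ℝ)) (modeSlope_nonneg τ)
    nlinarith

/-! ### Periodic harmonic functions on a strip and differentiation under the integral. -/

/-- `H` is a complex harmonic function on the strip `0 < t < T`, `2π`-periodic in `θ`, and the
other functions are its first partial derivatives, its second derivative in `t`, and its mixed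
second derivative. -/
structure IsHarmonicStrip (T : ℝ) (H Ht Hθ Htt Htθ : ℝ → ℝ → ℂ) : Prop where
  cont : ContinuousOn (fun p : ℝ × ℝ => H p.1 p.2) (Ioo 0 T ×ˢ univ)
  cont_t : ContinuousOn (fun p : ℝ × ℝ => Ht p.1 p.2) (Ioo 0 T ×ˢ univ)
  cont_θ : ContinuousOn (fun p : ℝ × ℝ => Hθ p.1 p.2) (Ioo 0 T ×ˢ univ)
  cont_tt : ContinuousOn (fun p : ℝ × ℝ => Htt p.1 p.2) (Ioo 0 T ×ˢ univ)
  cont_tθ : ContinuousOn (fun p : ℝ × ℝ => Htθ p.1 p.2) (Ioo 0 T ×ˢ univ)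
  deriv_t : ∀ t ∈ Ioo 0 T, ∀ θ, HasDerivAt (fun s => H s θ) (Ht t θ) t
  deriv_θ : ∀ t ∈ Ioo 0 T, ∀ θ, HasDerivAt (fun s => H t s) (Hθ t θ) θ
  deriv_tt : ∀ t ∈ Ioo 0 T, ∀ θ, HasDerivAt (fun s => Ht s θ) (Htt t θ) t
  deriv_tθ : ∀ t ∈ Ioo 0 T, ∀ θ, HasDerivAt (fun s => Ht t s) (Htθ t θ) θ
  deriv_θt : ∀ t ∈ Ioo 0 T, ∀ θ, HasDerivAt (fun s => Hθ s θ) (Htθ t θ) t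
  deriv_θθ : ∀ t ∈ Ioo 0 T, ∀ θ, HasDerivAt (fun s => Hθ t s) (-Htt t θ) θ
  periodic : ∀ t ∈ Ioo 0 T, H t (2 * Real.pi) = H t 0
  periodic_t : ∀ t ∈ Ioo 0 T, Ht t (2 * Real.pi) = Ht t 0
  periodic_θ : ∀ t ∈ Ioo 0 T, Hθ t (2 * Real.pi) = Hθ t 0

theorem ContinuousOn.strip_slice {E : Type*} [TopologicalSpace E] {T : ℝ} {f : ℝ → ℝ → E}
    (hf : ContinuousOn (fun p : ℝ × ℝ => f p.1 p.2) (Ioo 0 T ×ˢ univ)) {t : ℝ} (ht : t ∈ Ioo 0 T) :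
    Continuous (f t) := by
  have := hf.comp_continuous (f := fun θ : ℝ => (t, θ)) (by fun_prop) (fun θ => ⟨ht, mem_univ _⟩)
  exact this

theorem hasDerivAt_integral_strip {E : Type*} [NormedAddCommGroup E] [NormedSpace ℝ E]
    {T : ℝ} {f f' : ℝ → ℝ → E}
    (hf : ContinuousOn (fun p : ℝ × ℝ => f p.1 p.2) (Ioo 0 T ×ˢ univ))
    (hf' : ContinuousOn (fun p : ℝ × ℝ => f' p.1 p.2) (Ioo 0 T ×ˢ univ))
    (hd : ∀ t ∈ Ioo 0 T, ∀ θ, HasDerivAt (fun s => f s θ) (f' t θ) t) {t : ℝ} (ht : t ∈ Ioo 0 T)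
    (a b : ℝ) :
    HasDerivAt (fun s => ∫ θ in a..b, f s θ) (∫ θ in a..b, f' t θ) t := by
  obtain ⟨δ, hδ, hball⟩ := Metric.isOpen_iff.1 isOpen_Ioo t ht
  have hsub : Metric.closedBall t (δ / 2) ⊆ Ioo 0 T :=
    (Metric.closedBall_subset_ball (by linarith)).trans hball
  obtain ⟨M, hM⟩ := ((isCompact_closedBall t (δ / 2)).prod (isCompact_uIcc (a := a) (b := b))).exists_bound_of_continuousOn
    (hf'.mono (prod_mono hsub (subset_univ _)))
  refine (intervalIntegral.hasDerivAt_integral_of_dominated_loc_of_deriv_le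
    (s := Metric.closedBall t (δ / 2)) (bound := fun _ => M)
    (Metric.closedBall_mem_nhds t (by linarith)) ?_ ?_ ?_ ?_ ?_ ?_).2
  · filter_upwards [isOpen_Ioo.mem_nhds ht] with s hs
    exact (hf.strip_slice hs).aestronglyMeasurable
  · exact (hf.strip_slice ht).intervalIntegrable _ _
  · exact (hf'.strip_slice ht).aestronglyMeasurable
  · exact .of_forall fun θ hθ s hs => hM (s, θ) ⟨hs, uIoc_subset_uIcc hθ⟩
  · exact intervalIntegrable_const
  · exact .of_forall fun θ _ s hs => hd s (hsub hs) θ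

/-! ### Fourier modes and Parseval's identity. -/

/-- The `n`-th Fourier coefficient of a function on `[0, 2π]`. -/
noncomputable def fourierMode (n : ℤ) (f : ℝ → ℂ) : ℂ :=
  (2 * Real.pi : ℝ)⁻¹ • ∫ θ in (0 : ℝ)..(2 * Real.pi), Complex.exp (-(n * θ * Complex.I)) * f θ

theorem fourierMode_eq (n : ℤ) (f : ℝ → ℂ) :
    fourierMode n f = fourierCoeffOn Real.two_pi_pos f n := by
  rw [fourierCoeffOn_eq_integral, fourierMode]
  simp only [sub_zero, one_div, smul_eq_mul]
  congr 2
  ext θ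
  rw [fourier_coe_apply]
  congr 2
  have : (Real.pi : ℂ) ≠ 0 := by exact_mod_cast Real.pi_ne_zero
  push_cast
  rw [sub_zero]
  field_simp

theorem hasSum_sq_fourierMode {f : ℝ → ℂ} (hf : Continuous f) :
    HasSum (fun n => ‖fourierMode n f‖ ^ 2)
      ((2 * Real.pi)⁻¹ * ∫ θ in (0 : ℝ)..(2 * Real.pi), ‖f θ‖ ^ 2) := by
  have hL : MeasureTheory.MemLp f 2 (MeasureTheory.volume.restrict (Ioc 0 (2 * Real.pi))) := by
    obtain ⟨M, hM⟩ := (isCompact_Icc (a := 0) (b := 2 * Real.pi)).exists_bound_of_continuousOn hf.continuousOn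
    refine MeasureTheory.MemLp.of_bound hf.aestronglyMeasurable M ?_
    filter_upwards [MeasureTheory.self_mem_ae_restrict measurableSet_Ioc] with x hx
    exact hM x (Ioc_subset_Icc_self hx)
  have := hasSum_sq_fourierCoeffOn Real.two_pi_pos hL
  simpa only [fourierMode_eq, sub_zero, smul_eq_mul] using this

theorem fourierMode_add (n : ℤ) {f g : ℝ → ℂ} (hf : Continuous f) (hg : Continuous g) :
    fourierMode n (fun θ => f θ + g θ) = fourierMode n f + fourierMode n g := by
  simp only [fourierMode, mul_add]
  rw [intervalIntegral.integral_add, smul_add] <;>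
  exact Continuous.intervalIntegrable (by fun_prop) _ _

theorem fourierMode_const_mul (n : ℤ) (c : ℂ) (f : ℝ → ℂ) :
    fourierMode n (fun θ => c * f θ) = c * fourierMode n f := by
  simp only [fourierMode, mul_left_comm _ c]
  rw [intervalIntegral.integral_const_mul, mul_smul_comm]

theorem norm_add_sq_eq_re (a b : ℂ) :
    ‖a + b‖ ^ 2 = ‖a‖ ^ 2 + ‖b‖ ^ 2 + 2 * ((starRingEnd ℂ) a * b).re := by
  simp only [Complex.sq_norm, Complex.normSq_apply, Complex.add_re, Complex.add_im, Complex.mul_re,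
    Complex.conj_re, Complex.conj_im]
  ring

theorem hasSum_re_conj_mul_fourierMode {f g : ℝ → ℂ} (hf : Continuous f) (hg : Continuous g) :
    HasSum (fun n => ((starRingEnd ℂ) (fourierMode n f) * fourierMode n g).re)
      ((2 * Real.pi)⁻¹ * ∫ θ in (0 : ℝ)..(2 * Real.pi), ((starRingEnd ℂ) (f θ) * g θ).re) := by
  have h1 := hasSum_sq_fourierMode hf
  have h2 := hasSum_sq_fourierMode hg
  have h3 := hasSum_sq_fourierMode (hf.add hg)
  have h4 := ((h3.sub h1).sub h2).div_const 2
  have e1 : ∀ n, ((starRingEnd ℂ) (fourierMode n f) * fourierMode n g).re =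
      (‖fourierMode n (f + g)‖ ^ 2 - ‖fourierMode n f‖ ^ 2 - ‖fourierMode n g‖ ^ 2) / 2 := by
    intro n
    have : fourierMode n (f + g) = fourierMode n f + fourierMode n g := fourierMode_add n hf hg
    rw [this, norm_add_sq_eq_re]; ring
  simp only [e1]
  refine (congrArg (HasSum _) ?_).mp h4
  rw [← mul_sub, ← mul_sub, mul_div_assoc]
  congr 1
  have hi : ∀ {u : ℝ → ℝ}, Continuous u →
      IntervalIntegrable u MeasureTheory.volume 0 (2 * Real.pi) := fun hu => hu.intervalIntegrable _ _
  rw [← intervalIntegral.integral_sub (hi (by fun_prop)) (hi (by fun_prop)),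
    ← intervalIntegral.integral_sub (hi (by fun_prop)) (hi (by fun_prop)),
    ← intervalIntegral.integral_div]
  congr 1
  ext θ
  rw [Pi.add_apply, norm_add_sq_eq_re]; ring

theorem fourierMode_deriv (n : ℤ) {f f' : ℝ → ℂ} (hd : ∀ θ, HasDerivAt f (f' θ) θ)
    (hf' : Continuous f') (hp : f (2 * Real.pi) = f 0) :
    fourierMode n f' = n * Complex.I * fourierMode n f := by
  have hf : Continuous f := continuous_iff_continuousAt.2 fun θ => (hd θ).continuousAt
  have he : ∀ θ : ℝ, HasDerivAt (fun θ : ℝ => Complex.exp (-(n * θ * Complex.I)))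
      (-(n * Complex.I) * Complex.exp (-(n * θ * Complex.I))) θ := by
    intro θ
    have h1 : HasDerivAt (fun θ : ℝ => -((n : ℂ) * θ * Complex.I)) (-(n * Complex.I)) θ := by
      have := ((Complex.ofRealCLM.hasDerivAt (x := θ)).const_mul (n : ℂ)).mul_const Complex.I |>.neg
      simp only [Complex.ofRealCLM_apply, Complex.ofReal_one, mul_one] at this
      exact this
    simpa [mul_comm] using h1.cexp
  have key := intervalIntegral.integral_deriv_mul_eq_sub (a := 0) (b := 2 * Real.pi)
    (fun θ _ => he θ) (fun θ _ => hd θ)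
    (Continuous.intervalIntegrable (by fun_prop) _ _) (hf'.intervalIntegrable _ _)
  have e1 : Complex.exp (-(n * ((2 * Real.pi : ℝ) : ℂ) * Complex.I)) = 1 := by
    have := Complex.exp_int_mul_two_pi_mul_I (-n)
    rw [← this]; congr 1; push_cast; ring
  rw [e1, hp, intervalIntegral.integral_add (Continuous.intervalIntegrable (by fun_prop) _ _) (Continuous.intervalIntegrable (by fun_prop) _ _)] at key
  simp only [mul_assoc, intervalIntegral.integral_const_mul, Complex.ofReal_zero, mul_zero, zero_mul, neg_zero, Complex.exp_zero, one_mul, sub_self] at key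
  have key' := eq_neg_of_add_eq_zero_right key
  simp only [fourierMode]
  rw [mul_smul_comm]
  simp only [mul_assoc] at key' ⊢
  rw [key', neg_mul, neg_neg, mul_assoc]

/-- The mean over a period `[0, 2π]`. -/
noncomputable def periodMean (f : ℝ → ℝ) : ℝ := (2 * Real.pi)⁻¹ * ∫ θ in (0 : ℝ)..(2 * Real.pi), f θ

theorem hasDerivAt_fourierMode {T : ℝ} {f f' : ℝ → ℝ → ℂ}
    (hf : ContinuousOn (fun p : ℝ × ℝ => f p.1 p.2) (Ioo 0 T ×ˢ univ))
    (hf' : ContinuousOn (fun p : ℝ × ℝ => f' p.1 p.2) (Ioo 0 T ×ˢ univ))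
    (hd : ∀ t ∈ Ioo 0 T, ∀ θ, HasDerivAt (fun s => f s θ) (f' t θ) t) (n : ℤ) {t : ℝ}
    (ht : t ∈ Ioo 0 T) :
    HasDerivAt (fun s => fourierMode n (f s)) (fourierMode n (f' t)) t := by
  have hc : Continuous fun p : ℝ × ℝ => Complex.exp (-(n * p.2 * Complex.I)) := by fun_prop
  have := (hasDerivAt_integral_strip (f := fun t θ => Complex.exp (-(n * θ * Complex.I)) * f t θ)
    (f' := fun t θ => Complex.exp (-(n * θ * Complex.I)) * f' t θ)
    (hc.continuousOn.mul hf) (hc.continuousOn.mul hf')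
    (fun t ht θ => (hd t ht θ).const_mul _) ht 0 (2 * Real.pi))
  exact this.const_smul (2 * Real.pi : ℝ)⁻¹

theorem hasDerivAt_modeSinh (n : ℤ) (τ : ℝ) :
    HasDerivAt (modeSinh n) (Real.cosh (n * τ)) τ := by
  unfold modeSinh
  split_ifs with h
  · simpa [h] using hasDerivAt_id' τ
  · have hn : (n : ℝ) ≠ 0 := by exact_mod_cast h
    have := (((hasDerivAt_id τ).const_mul (n : ℝ)).sinh).div_const (n : ℝ)
    simpa [hn] using this

theorem sq_mul_modeSinh (n : ℤ) (τ : ℝ) : (n : ℝ) ^ 2 * modeSinh n τ = n * Real.sinh (n * τ) := by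
  unfold modeSinh
  split_ifs with h
  · simp [h]
  · have hn : (n : ℝ) ≠ 0 := by exact_mod_cast h
    field_simp

/-! ### Evolution of the modes and growth of the quadratic mean. -/

namespace IsHarmonicStrip

variable {T : ℝ} {H Ht Hθ Htt Htθ : ℝ → ℝ → ℂ}

theorem fourierMode_tt (h : IsHarmonicStrip T H Ht Hθ Htt Htθ) (n : ℤ) {t : ℝ} (ht : t ∈ Ioo 0 T) :
    fourierMode n (Htt t) = n ^ 2 * fourierMode n (H t) := by
  have h1 := fourierMode_deriv n (h.deriv_θ t ht) (h.cont_θ.strip_slice ht) (h.periodic t ht)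
  have h2 := fourierMode_deriv n (h.deriv_θθ t ht) (h.cont_tt.strip_slice ht).neg (h.periodic_θ t ht)
  have h3 := fourierMode_const_mul n (-1) (Htt t)
  simp only [neg_mul, one_mul] at h3
  rw [h3, h1] at h2
  linear_combination -h2 - n ^ 2 * fourierMode n (H t) * Complex.I_sq

theorem hasDerivAt_mode (h : IsHarmonicStrip T H Ht Hθ Htt Htθ) (n : ℤ) {t : ℝ} (ht : t ∈ Ioo 0 T) :
    HasDerivAt (fun s => fourierMode n (H s)) (fourierMode n (Ht t)) t :=
  hasDerivAt_fourierMode h.cont h.cont_t h.deriv_t n ht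

theorem hasDerivAt_mode_t (h : IsHarmonicStrip T H Ht Hθ Htt Htθ) (n : ℤ) {t : ℝ} (ht : t ∈ Ioo 0 T) :
    HasDerivAt (fun s => fourierMode n (Ht s)) (n ^ 2 * fourierMode n (H t)) t := by
  rw [← h.fourierMode_tt n ht]
  exact hasDerivAt_fourierMode h.cont_t h.cont_tt h.deriv_tt n ht

/-- Variation of the base point: the right-hand side, with `ε` replaced by a variable `s`, has zero
derivative in `s`, and at `s = t` it is the left-hand side. -/
theorem fourierMode_eq_cosh_add (h : IsHarmonicStrip T H Ht Hθ Htt Htθ) (n : ℤ) {ε t : ℝ} (h0 : 0 < ε)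
    (hεt : ε ≤ t) (ht : t < T) :
    fourierMode n (H t) = fourierMode n (H ε) * Real.cosh (n * (t - ε)) +
      fourierMode n (Ht ε) * modeSinh n (t - ε) := by
  have hd : ∀ s ∈ Icc ε t, HasDerivAt (fun s => fourierMode n (H s) * (Real.cosh (n * (t - s)) : ℂ) +
      fourierMode n (Ht s) * (modeSinh n (t - s) : ℂ)) 0 s := by
    intro s hs
    have hs' : s ∈ Ioo 0 T := ⟨h0.trans_le hs.1, hs.2.trans_lt ht⟩
    have e0 : HasDerivAt (fun s : ℝ => t - s) (-1) s := by
      simpa using (hasDerivAt_id s).const_sub t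
    have e1 := ((e0.const_mul (n : ℝ)).cosh).ofReal_comp
    have e2 := ((hasDerivAt_modeSinh n (t - s)).comp s e0).ofReal_comp
    have := ((h.hasDerivAt_mode n hs').mul e1).add ((h.hasDerivAt_mode_t n hs').mul e2)
    refine this.congr_deriv ?_
    have e3 : ((n : ℂ) ^ 2 * modeSinh n (t - s)) = n * Real.sinh (n * (t - s)) := by
      exact_mod_cast congrArg (fun x : ℝ => (x : ℂ)) (sq_mul_modeSinh n (t - s))
    simp only [Function.comp]
    push_cast at e3 ⊢
    linear_combination fourierMode n (H s) * e3
  have := constant_of_has_deriv_right_zero (fun s hs => (hd s hs).continuousAt.continuousWithinAt)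
    (fun s hs => (hd s ⟨hs.1, hs.2.le⟩).hasDerivWithinAt) t ⟨hεt, le_rfl⟩
  simp only [sub_self, mul_zero, Real.cosh_zero, Complex.ofReal_one, mul_one] at this
  rw [← this]
  simp [modeSinh]

theorem hasSum_mode_sq (h : IsHarmonicStrip T H Ht Hθ Htt Htθ) {t : ℝ} (ht : t ∈ Ioo 0 T) :
    HasSum (fun n => ‖fourierMode n (H t)‖ ^ 2) (periodMean fun θ => ‖H t θ‖ ^ 2) :=
  hasSum_sq_fourierMode (h.cont.strip_slice ht)

theorem hasSum_mode_area (h : IsHarmonicStrip T H Ht Hθ Htt Htθ) {t : ℝ} (ht : t ∈ Ioo 0 T) :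
    HasSum (fun n : ℤ => n * ‖fourierMode n (H t)‖ ^ 2)
      (periodMean fun θ => ((starRingEnd ℂ) (H t θ) * Hθ t θ).im) := by
  have hc := h.cont_θ.strip_slice ht
  -- Polarised Parseval for `H` and `-i Hθ`, since the modes of `-i Hθ` are `n` times those of `H`.
  have := hasSum_re_conj_mul_fourierMode (h.cont.strip_slice ht)
    (g := fun θ => -Complex.I * Hθ t θ) (by fun_prop)
  simp only [fourierMode_const_mul, fourierMode_deriv _ (h.deriv_θ t ht) hc (h.periodic t ht)] at this
  convert this using 3 with n n
  · rw [Complex.sq_norm, Complex.normSq_apply]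
    simp; ring
  · unfold periodMean
    congr 3
    ext θ
    simp; ring

theorem hasSum_mode_t (h : IsHarmonicStrip T H Ht Hθ Htt Htθ) {t : ℝ} (ht : t ∈ Ioo 0 T) :
    HasSum (fun n : ℤ => ((starRingEnd ℂ) (fourierMode n (H t)) * fourierMode n (Ht t)).re)
      (periodMean fun θ => ((starRingEnd ℂ) (H t θ) * Ht t θ).re) :=
  hasSum_re_conj_mul_fourierMode (h.cont.strip_slice ht) (h.cont_t.strip_slice ht)

theorem le_mean_sq (h : IsHarmonicStrip T H Ht Hθ Htt Htθ) {ε t : ℝ} (h0 : 0 < ε)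
    (hεt : ε < t) (ht : t < T) (hle : t - ε ≤ 3 / 2) :
    (Real.cosh (t - ε) ^ 2 - modeSlope (t - ε)) * (periodMean fun θ => ‖H ε θ‖ ^ 2) +
      modeSlope (t - ε) * (periodMean fun θ => ((starRingEnd ℂ) (H ε θ) * Hθ ε θ).im) +
      2 * (Real.sinh (t - ε) * Real.cosh (t - ε)) *
        (periodMean fun θ => ((starRingEnd ℂ) (H ε θ) * Ht ε θ).re) ≤
      periodMean fun θ => ‖H t θ‖ ^ 2 := by
  have hε' : ε ∈ Ioo 0 T := ⟨h0, hεt.trans ht⟩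
  refine hasSum_le (fun n => ?_) ((((h.hasSum_mode_sq hε').mul_left _).add
    ((h.hasSum_mode_area hε').mul_left _)).add ((h.hasSum_mode_t hε').mul_left _))
    (h.hasSum_mode_sq ⟨h0.trans hεt, ht⟩)
  rw [h.fourierMode_eq_cosh_add n h0 hεt.le ht]
  exact mode_bound (sub_pos.2 hεt) hle n _ _

theorem hasDerivAt_mean_sq (h : IsHarmonicStrip T H Ht Hθ Htt Htθ) {t : ℝ} (ht : t ∈ Ioo 0 T) :
    HasDerivAt (fun t => periodMean fun θ => ‖H t θ‖ ^ 2)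
      (2 * periodMean fun θ => ((starRingEnd ℂ) (H t θ) * Ht t θ).re) t := by
  have h1 : ContinuousOn (fun p : ℝ × ℝ => 2 * ((starRingEnd ℂ) (H p.1 p.2) * Ht p.1 p.2).re)
      (Ioo 0 T ×ˢ univ) := by
    exact continuousOn_const.mul (Complex.continuous_re.comp_continuousOn
      ((Complex.continuous_conj.comp_continuousOn h.cont).mul h.cont_t))
  have := (hasDerivAt_integral_strip (f := fun t θ => ‖H t θ‖ ^ 2)
    (f' := fun t θ => 2 * ((starRingEnd ℂ) (H t θ) * Ht t θ).re) (h.cont.norm.pow 2) h1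
    (fun t ht θ => ?_) ht 0 (2 * Real.pi)).const_mul (2 * Real.pi)⁻¹
  · refine this.congr_deriv ?_
    simp only [periodMean]
    rw [intervalIntegral.integral_const_mul]; ring
  · have := (h.deriv_t t ht θ).norm_sq
    refine this.congr_deriv ?_
    rw [Complex.inner, mul_comm (Ht t θ)]

/-- Termwise, the derivative is `|(c n)'|² + n² |c n|² ≥ 0`. Comparing the sums mode by mode avoids
differentiating the series. -/
theorem monotoneOn_mean_t (h : IsHarmonicStrip T H Ht Hθ Htt Htθ) :
    MonotoneOn (fun t => periodMean fun θ => ((starRingEnd ℂ) (H t θ) * Ht t θ).re) (Ioo 0 T) := by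
  intro s hs t ht hst
  refine hasSum_le (fun n => ?_) (h.hasSum_mode_t hs) (h.hasSum_mode_t ht)
  have hd : ∀ x ∈ Ioo 0 T, HasDerivAt
      (fun x => ((starRingEnd ℂ) (fourierMode n (H x)) * fourierMode n (Ht x)).re)
      (‖fourierMode n (Ht x)‖ ^ 2 + n ^ 2 * ‖fourierMode n (H x)‖ ^ 2) x := by
    intro x hx
    have h1 := h.hasDerivAt_mode n hx
    have h2 := h.hasDerivAt_mode_t n hx
    have h3 := (h1.star.mul h2)
    have h4 := (Complex.reCLM.hasFDerivAt.comp_hasDerivAt x h3)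
    refine h4.congr_deriv ?_
    rw [Complex.sq_norm, Complex.sq_norm]
    simp only [Complex.normSq_apply, Complex.reCLM_apply, Complex.add_re, Complex.star_def,
      Complex.mul_re, Complex.mul_im, Complex.conj_re, Complex.conj_im, pow_two,
      Complex.intCast_re, Complex.intCast_im]
    ring
  refine monotoneOn_of_deriv_nonneg (convex_Ioo 0 T)
    (fun x hx => (hd x hx).continuousAt.continuousWithinAt)
    (fun x hx => (hd x (interior_subset hx)).differentiableAt.differentiableWithinAt)
    (fun x hx => ?_) hs ht hst
  rw [(hd x (interior_subset hx)).deriv]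
  positivity

/-- If this mean were negative at `t`, by monotonicity it would be negative on all of `(0, t]`. The
mean square would then decrease strictly from its limit `1`, hence fall below `1`. -/
theorem mean_t_nonneg (h : IsHarmonicStrip T H Ht Hθ Htt Htθ)
    (hlim : Tendsto (fun t => periodMean fun θ => ‖H t θ‖ ^ 2) (𝓝[>] 0) (𝓝 1))
    (hge : ∀ t ∈ Ioo 0 T, 1 ≤ periodMean fun θ => ‖H t θ‖ ^ 2) {t : ℝ} (ht : t ∈ Ioo 0 T) :
    0 ≤ periodMean fun θ => ((starRingEnd ℂ) (H t θ) * Ht t θ).re := by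
  by_contra! hneg
  have hsub : Ioc 0 t ⊆ Ioo 0 T := fun x hx => ⟨hx.1, hx.2.trans_lt ht.2⟩
  have hanti : StrictAntiOn (fun t => periodMean fun θ => ‖H t θ‖ ^ 2) (Ioc 0 t) := by
    refine strictAntiOn_of_deriv_neg (convex_Ioc 0 t)
      (fun x hx => (h.hasDerivAt_mean_sq (hsub hx)).continuousAt.continuousWithinAt) fun x hx => ?_
    have hx' := interior_subset hx
    rw [(h.hasDerivAt_mean_sq (hsub hx')).deriv]
    have := h.monotoneOn_mean_t (hsub hx') ht hx'.2
    simp only at this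
    linarith
  have ht0 : 0 < t := ht.1
  have h1 := hanti (⟨by linarith, by linarith⟩ : t / 2 ∈ Ioc 0 t) ⟨ht0, le_rfl⟩ (by linarith)
  have h2 : (periodMean fun θ => ‖H (t / 2) θ‖ ^ 2) ≤ 1 := by
    refine ge_of_tendsto hlim ?_
    filter_upwards [Ioo_mem_nhdsGT (by linarith : 0 < t / 2)] with s hs
    exact hanti.antitoneOn ⟨hs.1, by linarith [hs.2]⟩ ⟨by linarith, by linarith⟩ hs.2.le
  have h3 := hge t ht
  simp only at h1
  linarith

theorem cosh_sq_le_mean_sq (h : IsHarmonicStrip T H Ht Hθ Htt Htθ)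
    (hlim : Tendsto (fun t => periodMean fun θ => ‖H t θ‖ ^ 2) (𝓝[>] 0) (𝓝 1))
    (hge : ∀ t ∈ Ioo 0 T, 1 ≤ periodMean fun θ => ‖H t θ‖ ^ 2)
    (harea : ∀ t ∈ Ioo 0 T, 1 ≤ periodMean fun θ => ((starRingEnd ℂ) (H t θ) * Hθ t θ).im)
    {t : ℝ} (ht : t ∈ Ioo 0 T) (hle : t ≤ 3 / 2) :
    Real.cosh t ^ 2 ≤ periodMean fun θ => ‖H t θ‖ ^ 2 := by
  have hk : Tendsto (fun ε => modeSlope (t - ε)) (𝓝[>] 0) (𝓝 (modeSlope t)) := by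
    have : ContinuousAt (fun ε => modeSlope (t - ε)) 0 := by
      unfold modeSlope
      have : t - 0 ≠ 0 := by simpa using ht.1.ne'
      fun_prop (disch := assumption)
    simpa using this.tendsto.mono_left nhdsWithin_le_nhds
  have hc : Tendsto (fun ε => Real.cosh (t - ε) ^ 2) (𝓝[>] 0) (𝓝 (Real.cosh t ^ 2)) := by
    have : ContinuousAt (fun ε => Real.cosh (t - ε) ^ 2) 0 := by fun_prop
    simpa using this.tendsto.mono_left nhdsWithin_le_nhds
  have hl := ((hc.sub hk).mul hlim).add hk
  rw [mul_one, sub_add_cancel] at hl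
  refine le_of_tendsto hl ?_
  filter_upwards [Ioo_mem_nhdsGT ht.1] with ε hε
  have hε' : ε ∈ Ioo 0 T := ⟨hε.1, hε.2.trans ht.2⟩
  have h1 := h.le_mean_sq hε.1 hε.2 ht.2 (by linarith [hε.1])
  have h2 := mul_le_mul_of_nonneg_left (harea ε hε') (modeSlope_nonneg (t - ε))
  have h3 : 0 ≤ Real.sinh (t - ε) := Real.sinh_nonneg_iff.2 (by linarith [hε.2])
  have h4 := mul_nonneg (mul_nonneg zero_le_two (mul_nonneg h3 (Real.cosh_pos (t - ε)).le))
    (h.mean_t_nonneg hlim hge hε')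
  linarith

end IsHarmonicStrip

/-! ### Passing from a harmonic function in the plane to the strip. -/

/-- Locally `f` is the real part of an analytic function, and composition preserves this. -/
theorem HarmonicAt.comp_analyticAt {f : ℂ → ℝ} {g : ℂ → ℂ} {w : ℂ}
    (hf : InnerProductSpace.HarmonicAt f (g w)) (hg : AnalyticAt ℂ g w) :
    InnerProductSpace.HarmonicAt (f ∘ g) w := by
  obtain ⟨r, hr, hball⟩ := Metric.isOpen_iff.1 (InnerProductSpace.isOpen_setOfPred_harmonicAt f) (g w) hf
  obtain ⟨F, hF, hFf⟩ := InnerProductSpace.HarmonicOnNhd.exists_analyticOnNhd_ball_re_eq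
    (f := f) (z := g w) (R := r) (fun x hx => hball hx)
  have h1 : AnalyticAt ℂ (F ∘ g) w := (hF (g w) (Metric.mem_ball_self hr)).comp hg
  refine (InnerProductSpace.harmonicAt_congr_nhds ?_).1 h1.harmonicAt_re
  filter_upwards [hg.continuousAt.preimage_mem_nhds (Metric.ball_mem_nhds (g w) hr)] with x hx
  exact hFf hx

theorem HarmonicAt.comp_analyticAt_complex {f g : ℂ → ℂ} {w : ℂ}
    (hf : InnerProductSpace.HarmonicAt f (g w)) (hg : AnalyticAt ℂ g w) :
    InnerProductSpace.HarmonicAt (f ∘ g) w := by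
  have h1 := (HarmonicAt.comp_analyticAt (hf.comp_CLM Complex.reCLM) hg).comp_CLM Complex.ofRealCLM
  have h2 := (HarmonicAt.comp_analyticAt (hf.comp_CLM Complex.imCLM) hg).comp_CLM
    (Complex.ofRealCLM.smulRight Complex.I)
  convert h1.add h2 using 1
  ext x
  simp [Complex.re_add_im]

/-- The point `t + iθ`. -/
def stripPt (t θ : ℝ) : ℂ := t + θ * Complex.I

theorem hasDerivAt_stripPt_left (t θ : ℝ) : HasDerivAt (fun t => stripPt t θ) 1 t :=
  (Complex.ofRealCLM.hasDerivAt (x := t)).add_const _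

theorem hasDerivAt_stripPt_right (t θ : ℝ) : HasDerivAt (fun θ => stripPt t θ) Complex.I θ := by
  have := ((Complex.ofRealCLM.hasDerivAt (x := θ)).mul_const Complex.I).const_add (t : ℂ)
  simp only [Complex.ofRealCLM_apply, Complex.ofReal_one, one_mul] at this
  exact this

theorem HasDerivAt.clm_apply_const {L : ℝ → ℂ →L[ℝ] ℂ} {L' : ℂ →L[ℝ] ℂ} {x : ℝ}
    (h : HasDerivAt L L' x) (v : ℂ) : HasDerivAt (fun s => L s v) (L' v) x := by
  simpa using h.clm_apply (hasDerivAt_const x v)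

theorem isHarmonicStrip_of_harmonicOnNhd {T : ℝ} {K : ℂ → ℂ}
    (hK : InnerProductSpace.HarmonicOnNhd K {w | 0 < w.re ∧ w.re < T})
    (hp : ∀ w, K (w + 2 * Real.pi * Complex.I) = K w) :
    IsHarmonicStrip T (fun t θ => K (stripPt t θ)) (fun t θ => fderiv ℝ K (stripPt t θ) 1)
      (fun t θ => fderiv ℝ K (stripPt t θ) Complex.I)
      (fun t θ => fderiv ℝ (fderiv ℝ K) (stripPt t θ) 1 1)
      (fun t θ => fderiv ℝ (fderiv ℝ K) (stripPt t θ) Complex.I 1) := by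
  have hS : IsOpen {w : ℂ | 0 < w.re ∧ w.re < T} :=
    (isOpen_lt continuous_const Complex.continuous_re).inter
      (isOpen_lt Complex.continuous_re continuous_const)
  have hmem : ∀ t ∈ Ioo 0 T, ∀ θ, stripPt t θ ∈ {w : ℂ | 0 < w.re ∧ w.re < T} := by
    intro t ht θ; simpa [stripPt] using ht
  have hm : MapsTo (fun p : ℝ × ℝ => stripPt p.1 p.2) (Ioo 0 T ×ˢ univ)
      {w : ℂ | 0 < w.re ∧ w.re < T} := fun p hp => hmem p.1 hp.1 p.2
  have hc : ContinuousOn (fun p : ℝ × ℝ => stripPt p.1 p.2) (Ioo 0 T ×ˢ univ) := by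
    unfold stripPt; fun_prop
  have h2 := hK.contDiffOn
  have h1 : ContDiffOn ℝ 1 (fderiv ℝ K) {w | 0 < w.re ∧ w.re < T} :=
    h2.fderiv_of_isOpen hS (by norm_num)
  have c1 := h1.continuousOn.comp hc hm
  have c2 := (h1.continuousOn_fderiv_of_isOpen hS le_rfl).comp hc hm
  have d1 : ∀ t ∈ Ioo 0 T, ∀ θ, HasFDerivAt K (fderiv ℝ K (stripPt t θ)) (stripPt t θ) :=
    fun t ht θ => ((hK _ (hmem t ht θ)).1.differentiableAt (by norm_num)).hasFDerivAt
  have d2 : ∀ t ∈ Ioo 0 T, ∀ θ, HasFDerivAt (fderiv ℝ K) (fderiv ℝ (fderiv ℝ K) (stripPt t θ))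
      (stripPt t θ) := fun t ht θ =>
    ((h1.contDiffAt (hS.mem_nhds (hmem t ht θ))).differentiableAt (by norm_num)).hasFDerivAt
  have hsym : ∀ t ∈ Ioo 0 T, ∀ θ, fderiv ℝ (fderiv ℝ K) (stripPt t θ) 1 Complex.I =
      fderiv ℝ (fderiv ℝ K) (stripPt t θ) Complex.I 1 := fun t ht θ =>
    (hK _ (hmem t ht θ)).1.isSymmSndFDerivAt (by simp) _ _
  have hlap : ∀ t ∈ Ioo 0 T, ∀ θ, fderiv ℝ (fderiv ℝ K) (stripPt t θ) Complex.I Complex.I =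
      - fderiv ℝ (fderiv ℝ K) (stripPt t θ) 1 1 := by
    intro t ht θ
    have := (hK _ (hmem t ht θ)).2.self_of_nhds
    rw [InnerProductSpace.laplacian_eq_iteratedFDeriv_complexPlane] at this
    simp only [iteratedFDeriv_two_apply] at this
    exact eq_neg_of_add_eq_zero_right this
  have hper : ∀ t, stripPt t (2 * Real.pi) = stripPt t 0 + 2 * Real.pi * Complex.I := by
    intro t; simp [stripPt]
  have hperd : ∀ w, fderiv ℝ K (w + 2 * Real.pi * Complex.I) = fderiv ℝ K w := by
    intro w
    rw [← fderiv_comp_add_right]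
    simp only [hp]
  refine ⟨h2.continuousOn.comp hc hm, ?_, ?_, ?_, ?_, ?_, ?_, ?_, ?_, ?_, ?_, ?_, ?_, ?_⟩
  · exact c1.clm_apply continuousOn_const
  · exact c1.clm_apply continuousOn_const
  · exact (c2.clm_apply continuousOn_const).clm_apply continuousOn_const
  · exact (c2.clm_apply continuousOn_const).clm_apply continuousOn_const
  · exact fun t ht θ => (d1 t ht θ).comp_hasDerivAt t (hasDerivAt_stripPt_left t θ)
  · exact fun t ht θ => (d1 t ht θ).comp_hasDerivAt θ (hasDerivAt_stripPt_right t θ)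
  · intro t ht θ
    exact (d2 t ht θ).comp_hasDerivAt t (hasDerivAt_stripPt_left t θ) |>.clm_apply_const _
  · intro t ht θ
    exact (d2 t ht θ).comp_hasDerivAt θ (hasDerivAt_stripPt_right t θ) |>.clm_apply_const _
  · intro t ht θ
    rw [← hsym t ht θ]
    exact (d2 t ht θ).comp_hasDerivAt t (hasDerivAt_stripPt_left t θ) |>.clm_apply_const _
  · intro t ht θ
    rw [← hlap t ht θ]
    exact (d2 t ht θ).comp_hasDerivAt θ (hasDerivAt_stripPt_right t θ) |>.clm_apply_const _
  · intro t _; simp only [hper, hp]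
  · intro t _; simp only [hper, hperd]
  · intro t _; simp only [hper, hperd]

/-! ### Winding of the image curves and the area bound. -/

theorem exists_int_integral_logDeriv {f f' : ℝ → ℂ} (hd : ∀ θ, HasDerivAt f (f' θ) θ)
    (hf' : Continuous f') (h0 : ∀ θ, f θ ≠ 0) {a b : ℝ} (hp : f b = f a) :
    ∃ n : ℤ, ∫ θ in a..b, ((starRingEnd ℂ) (f θ) * f' θ).im / ‖f θ‖ ^ 2 = 2 * Real.pi * n := by
  have hf : Continuous f := continuous_iff_continuousAt.2 fun θ => (hd θ).continuousAt
  have hc : Continuous fun θ => f' θ / f θ := hf'.div hf h0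
  have hL : ∀ θ, HasDerivAt (fun x => ∫ s in a..x, f' s / f s) (f' θ / f θ) θ := fun θ =>
    intervalIntegral.integral_hasDerivAt_right (hc.intervalIntegrable _ _)
      (hc.stronglyMeasurableAtFilter _ _) hc.continuousAt
  -- As `f * exp (-∫ f'/f)` is constant and `f` closes up, the exponential of the full integral is
  -- `1`.
  have hE : ∀ θ, HasDerivAt (fun x => Complex.exp (-∫ s in a..x, f' s / f s) * f x) 0 θ := by
    intro θ
    refine ((hL θ).neg.cexp.mul (hd θ)).congr_deriv ?_
    have := h0 θ
    simp only [Pi.neg_apply]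
    field_simp
    ring
  have hconst := is_const_of_deriv_eq_zero (fun θ => (hE θ).differentiableAt) (fun θ => (hE θ).deriv) b a
  simp only [intervalIntegral.integral_same, neg_zero, Complex.exp_zero, one_mul, hp] at hconst
  have h1 : Complex.exp (-∫ s in a..b, f' s / f s) = 1 := mul_right_cancel₀ (h0 a) (by rw [hconst, one_mul])
  obtain ⟨n, hn⟩ := Complex.exp_eq_one_iff.1 h1
  refine ⟨-n, ?_⟩
  have h2 : ∀ θ, ((starRingEnd ℂ) (f θ) * f' θ).im / ‖f θ‖ ^ 2 = (f' θ / f θ).im := by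
    intro θ
    rw [Complex.div_im, Complex.sq_norm]
    simp only [Complex.mul_im, Complex.conj_re, Complex.conj_im]
    ring
  simp only [h2]
  have h3 : (∫ s in a..b, f' s / f s).im = ∫ s in a..b, (f' s / f s).im :=
    (Complex.imCLM.intervalIntegral_comp_comm (hc.intervalIntegrable a b)).symm
  rw [← h3, ← neg_neg (∫ s in a..b, f' s / f s), hn]
  simp
  ring

namespace IsHarmonicStrip

variable {T : ℝ} {H Ht Hθ Htt Htθ : ℝ → ℝ → ℂ}

/-- Green's formula: with `F x = G x / x`, the form `F(|w|²) Im (conj w dw)` has exterior derivative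
`2 (F + x F')` times the area form, at `x = |w|²`, and `F + x F' = g`. -/
theorem hasDerivAt_weighted_area (h : IsHarmonicStrip T H Ht Hθ Htt Htθ)
    (h0 : ∀ t ∈ Ioo 0 T, ∀ θ, H t θ ≠ 0) {G g : ℝ → ℝ} (hG : ∀ x, HasDerivAt G (g x) x)
    (hg : Continuous g) {t : ℝ} (ht : t ∈ Ioo 0 T) :
    HasDerivAt (fun t => ∫ θ in (0 : ℝ)..(2 * Real.pi),
        G (‖H t θ‖ ^ 2) / ‖H t θ‖ ^ 2 * ((starRingEnd ℂ) (H t θ) * Hθ t θ).im)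
      (∫ θ in (0 : ℝ)..(2 * Real.pi),
        2 * g (‖H t θ‖ ^ 2) * ((starRingEnd ℂ) (Ht t θ) * Hθ t θ).im) t := by
  have hGc : Continuous G := continuous_iff_continuousAt.2 fun x => (hG x).continuousAt
  obtain ⟨F, hF⟩ : ∃ F : ℝ → ℝ, F = fun x => G x / x := ⟨_, rfl⟩
  obtain ⟨F', hF'⟩ : ∃ F' : ℝ → ℝ, F' = fun x => (g x * x - G x) / x ^ 2 := ⟨_, rfl⟩
  have hFd : ∀ x, 0 < x → HasDerivAt F (F' x) x := by
    intro x hx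
    rw [hF, hF']
    simpa using (hG x).fun_div (hasDerivAt_id' x) hx.ne'
  have hFF : ∀ x, 0 < x → F x + x * F' x = g x := by
    intro x hx
    rw [hF, hF']
    field_simp
    ring
  have hFc : ContinuousOn F (Ioi 0) := fun x hx => (hFd x hx).continuousAt.continuousWithinAt
  have hFc' : ContinuousOn F' (Ioi 0) := by
    rw [hF']
    refine ContinuousOn.div (by fun_prop) (by fun_prop) fun x hx => pow_ne_zero 2 (ne_of_gt hx)
  have hpos : ∀ t ∈ Ioo 0 T, ∀ θ, 0 < ‖H t θ‖ ^ 2 := fun t ht θ =>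
    pow_pos (norm_pos_iff.2 (h0 t ht θ)) 2
  have hr : ContinuousOn (fun p : ℝ × ℝ => ‖H p.1 p.2‖ ^ 2) (Ioo 0 T ×ˢ univ) := h.cont.norm.pow 2
  have hmaps : MapsTo (fun p : ℝ × ℝ => ‖H p.1 p.2‖ ^ 2) (Ioo 0 T ×ˢ univ) (Ioi 0) :=
    fun p hp => hpos p.1 hp.1 p.2
  have c1 := hFc.comp hr hmaps
  have c2 := hFc'.comp hr hmaps
  have conj_mul : ∀ {u v : ℝ → ℝ → ℂ}, ContinuousOn (fun p : ℝ × ℝ => u p.1 p.2) (Ioo 0 T ×ˢ univ) →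
      ContinuousOn (fun p : ℝ × ℝ => v p.1 p.2) (Ioo 0 T ×ˢ univ) →
      ContinuousOn (fun p : ℝ × ℝ => (starRingEnd ℂ) (u p.1 p.2) * v p.1 p.2) (Ioo 0 T ×ˢ univ) :=
    fun hu hv => (Complex.continuous_conj.comp_continuousOn hu).mul hv
  have re_c : ∀ {u v : ℝ → ℝ → ℂ}, ContinuousOn (fun p : ℝ × ℝ => u p.1 p.2) (Ioo 0 T ×ˢ univ) →
      ContinuousOn (fun p : ℝ × ℝ => v p.1 p.2) (Ioo 0 T ×ˢ univ) →
      ContinuousOn (fun p : ℝ × ℝ => ((starRingEnd ℂ) (u p.1 p.2) * v p.1 p.2).re) (Ioo 0 T ×ˢ univ) :=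
    fun hu hv => Complex.continuous_re.comp_continuousOn (conj_mul hu hv)
  have im_c : ∀ {u v : ℝ → ℝ → ℂ}, ContinuousOn (fun p : ℝ × ℝ => u p.1 p.2) (Ioo 0 T ×ˢ univ) →
      ContinuousOn (fun p : ℝ × ℝ => v p.1 p.2) (Ioo 0 T ×ˢ univ) →
      ContinuousOn (fun p : ℝ × ℝ => ((starRingEnd ℂ) (u p.1 p.2) * v p.1 p.2).im) (Ioo 0 T ×ˢ univ) :=
    fun hu hv => Complex.continuous_im.comp_continuousOn (conj_mul hu hv)
  have im_d : ∀ {u v : ℝ → ℂ} {u' v' : ℂ} {x : ℝ}, HasDerivAt u u' x → HasDerivAt v v' x →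
      HasDerivAt (fun x => ((starRingEnd ℂ) (u x) * v x).im)
        ((starRingEnd ℂ) u' * v x + (starRingEnd ℂ) (u x) * v').im x := fun hu hv =>
    Complex.imCLM.hasFDerivAt.comp_hasDerivAt _ (hu.star.mul hv)
  have nsq_d : ∀ {u : ℝ → ℂ} {u' : ℂ} {x : ℝ}, HasDerivAt u u' x →
      HasDerivAt (fun x => ‖u x‖ ^ 2) (2 * ((starRingEnd ℂ) (u x) * u').re) x := by
    intro u u' x hu
    refine hu.norm_sq.congr_deriv ?_
    rw [Complex.inner, mul_comm u']
  have key := hasDerivAt_integral_strip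
    (f := fun t θ => F (‖H t θ‖ ^ 2) * ((starRingEnd ℂ) (H t θ) * Hθ t θ).im)
    (f' := fun t θ => F' (‖H t θ‖ ^ 2) * (2 * ((starRingEnd ℂ) (H t θ) * Ht t θ).re) *
        ((starRingEnd ℂ) (H t θ) * Hθ t θ).im +
      F (‖H t θ‖ ^ 2) * ((starRingEnd ℂ) (Ht t θ) * Hθ t θ + (starRingEnd ℂ) (H t θ) * Htθ t θ).im)
    (c1.mul (im_c h.cont h.cont_θ))
    (((c2.mul ((continuousOn_const (c := (2 : ℝ))).mul (re_c h.cont h.cont_t))).mul (im_c h.cont h.cont_θ)).add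
      (c1.mul (Complex.continuous_im.comp_continuousOn
        ((conj_mul h.cont_t h.cont_θ).add (conj_mul h.cont h.cont_tθ)))))
    (fun t ht θ => ((hFd _ (hpos t ht θ)).comp t (nsq_d (h.deriv_t t ht θ))).mul
      (im_d (h.deriv_t t ht θ) (h.deriv_θt t ht θ))) ht 0 (2 * Real.pi)
  -- The other component of the pulled-back form; its `θ`-derivative integrates to zero over a
  -- period and accounts for the difference of the two integrands.
  have hθ : ∀ θ, HasDerivAt (fun θ => F (‖H t θ‖ ^ 2) * ((starRingEnd ℂ) (H t θ) * Ht t θ).im)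
      (F' (‖H t θ‖ ^ 2) * (2 * ((starRingEnd ℂ) (H t θ) * Hθ t θ).re) *
        ((starRingEnd ℂ) (H t θ) * Ht t θ).im +
      F (‖H t θ‖ ^ 2) * ((starRingEnd ℂ) (Hθ t θ) * Ht t θ + (starRingEnd ℂ) (H t θ) * Htθ t θ).im) θ :=
    fun θ => ((hFd _ (hpos t ht θ)).comp θ (nsq_d (h.deriv_θ t ht θ))).mul
      (im_d (h.deriv_θ t ht θ) (h.deriv_tθ t ht θ))
  have c3 := (((c2.mul ((continuousOn_const (c := (2 : ℝ))).mul (re_c h.cont h.cont_θ))).mul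
      (im_c h.cont h.cont_t)).add (c1.mul (Complex.continuous_im.comp_continuousOn
        ((conj_mul h.cont_θ h.cont_t).add (conj_mul h.cont h.cont_tθ)))))
  have c4 : Continuous fun θ => F' (‖H t θ‖ ^ 2) * (2 * ((starRingEnd ℂ) (H t θ) * Hθ t θ).re) *
        ((starRingEnd ℂ) (H t θ) * Ht t θ).im +
      F (‖H t θ‖ ^ 2) * ((starRingEnd ℂ) (Hθ t θ) * Ht t θ + (starRingEnd ℂ) (H t θ) * Htθ t θ).im :=
    c3.strip_slice (f := fun t θ => F' (‖H t θ‖ ^ 2) * (2 * ((starRingEnd ℂ) (H t θ) * Hθ t θ).re) *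
        ((starRingEnd ℂ) (H t θ) * Ht t θ).im +
      F (‖H t θ‖ ^ 2) * ((starRingEnd ℂ) (Hθ t θ) * Ht t θ + (starRingEnd ℂ) (H t θ) * Htθ t θ).im) ht
  have hz := intervalIntegral.integral_eq_sub_of_hasDerivAt (a := 0) (b := 2 * Real.pi)
    (fun θ _ => hθ θ) (c4.intervalIntegrable _ _)
  rw [h.periodic t ht, h.periodic_t t ht, sub_self] at hz
  have c5 : Continuous fun θ => 2 * g (‖H t θ‖ ^ 2) * ((starRingEnd ℂ) (Ht t θ) * Hθ t θ).im :=
    ((continuousOn_const.mul (hg.comp_continuousOn hr)).mul (im_c h.cont_t h.cont_θ)).strip_slice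
      (f := fun t θ => 2 * g (‖H t θ‖ ^ 2) * ((starRingEnd ℂ) (Ht t θ) * Hθ t θ).im) ht
  simp only [hF] at key
  refine key.congr_deriv ?_
  refine Eq.trans ?_ ((congrArg _ hz).trans (add_zero _))
  rw [← intervalIntegral.integral_add (c5.intervalIntegrable _ _) (c4.intervalIntegrable _ _)]
  congr 1
  ext θ
  rw [← hFF _ (hpos t ht θ)]
  simp only [hF]
  generalize F' (‖H t θ‖ ^ 2) = A
  generalize G (‖H t θ‖ ^ 2) / ‖H t θ‖ ^ 2 = B
  rw [Complex.sq_norm, Complex.normSq_apply]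
  simp only [Complex.add_im, Complex.mul_im, Complex.mul_re, Complex.conj_re, Complex.conj_im]
  ring

end IsHarmonicStrip

namespace IsHarmonicStrip

variable {T : ℝ} {H Ht Hθ Htt Htθ : ℝ → ℝ → ℂ}

theorem ne_zero_of_one_lt (hgt : ∀ t ∈ Ioo 0 T, ∀ θ, 1 < ‖H t θ‖ ^ 2) :
    ∀ t ∈ Ioo 0 T, ∀ θ, H t θ ≠ 0 := by
  intro t ht θ h0
  have := hgt t ht θ
  rw [h0] at this
  norm_num at this

/-- The area form weighted by a primitive, vanishing at `1`, of a function `g`. -/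
noncomputable def weightedArea (g : ℝ → ℝ) (H Hθ : ℝ → ℝ → ℂ) (t : ℝ) : ℝ :=
  ∫ θ in (0 : ℝ)..(2 * Real.pi),
    (∫ x in (1 : ℝ)..‖H t θ‖ ^ 2, g x) / ‖H t θ‖ ^ 2 * ((starRingEnd ℂ) (H t θ) * Hθ t θ).im

theorem hasDerivAt_weightedArea (h : IsHarmonicStrip T H Ht Hθ Htt Htθ)
    (hgt : ∀ t ∈ Ioo 0 T, ∀ θ, 1 < ‖H t θ‖ ^ 2) {g : ℝ → ℝ} (hg : Continuous g) {t : ℝ}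
    (ht : t ∈ Ioo 0 T) :
    HasDerivAt (weightedArea g H Hθ) (∫ θ in (0 : ℝ)..(2 * Real.pi),
        2 * g (‖H t θ‖ ^ 2) * ((starRingEnd ℂ) (Ht t θ) * Hθ t θ).im) t :=
  h.hasDerivAt_weighted_area (ne_zero_of_one_lt hgt) (G := fun y => ∫ x in (1 : ℝ)..y, g x)
    (fun _ => intervalIntegral.integral_hasDerivAt_right (hg.intervalIntegrable _ _)
      (hg.stronglyMeasurableAtFilter _ _) hg.continuousAt) hg ht

theorem monotoneOn_weightedArea (h : IsHarmonicStrip T H Ht Hθ Htt Htθ)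
    (hgt : ∀ t ∈ Ioo 0 T, ∀ θ, 1 < ‖H t θ‖ ^ 2)
    (hJ : ∀ t ∈ Ioo 0 T, ∀ θ, 0 ≤ ((starRingEnd ℂ) (Ht t θ) * Hθ t θ).im)
    {g : ℝ → ℝ} (hg : Continuous g) (hg0 : ∀ x, 0 ≤ g x) :
    MonotoneOn (weightedArea g H Hθ) (Ioo 0 T) := by
  have hd : ∀ t ∈ Ioo 0 T, _ := fun t ht => h.hasDerivAt_weightedArea hgt hg ht
  refine monotoneOn_of_deriv_nonneg (convex_Ioo 0 T)
    (fun x hx => (hd x hx).continuousAt.continuousWithinAt)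
    (fun x hx => (hd x (interior_subset hx)).differentiableAt.differentiableWithinAt)
    (fun x hx => ?_)
  have hx' := interior_subset hx
  rw [(hd x hx').deriv]
  refine intervalIntegral.integral_nonneg Real.two_pi_pos.le fun θ _ => ?_
  exact mul_nonneg (mul_nonneg zero_le_two (hg0 _)) (hJ x hx' θ)

theorem eventually_weightedArea_eq_zero (hgt : ∀ t ∈ Ioo 0 T, ∀ θ, 1 < ‖H t θ‖ ^ 2) (hT : 0 < T)
    (hun : ∀ δ > 0, ∀ᶠ t in 𝓝[>] 0, ∀ θ, ‖H t θ‖ ^ 2 ≤ 1 + δ)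
    {g : ℝ → ℝ} {δ : ℝ} (hδ : 0 < δ) (hgδ : ∀ x ≤ 1 + δ, g x = 0) :
    ∀ᶠ t in 𝓝[>] 0, weightedArea g H Hθ t = 0 := by
  filter_upwards [hun δ hδ, Ioo_mem_nhdsGT hT] with t ht ht'
  have : ∀ θ, ∫ x in (1 : ℝ)..‖H t θ‖ ^ 2, g x = 0 := by
    intro θ
    refine intervalIntegral.integral_zero_ae (.of_forall fun x hx => hgδ x ?_)
    rw [uIoc_of_le (hgt t ht' θ).le] at hx
    exact hx.2.trans (ht θ)
  simp [weightedArea, this]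

/-- As `g` vanishes up to `1 + δ`, the weighted area is zero for small `t`; it then increases
because the Jacobian is nonnegative. -/
theorem weightedArea_nonneg (h : IsHarmonicStrip T H Ht Hθ Htt Htθ)
    (hgt : ∀ t ∈ Ioo 0 T, ∀ θ, 1 < ‖H t θ‖ ^ 2)
    (hun : ∀ δ > 0, ∀ᶠ t in 𝓝[>] 0, ∀ θ, ‖H t θ‖ ^ 2 ≤ 1 + δ)
    (hJ : ∀ t ∈ Ioo 0 T, ∀ θ, 0 ≤ ((starRingEnd ℂ) (Ht t θ) * Hθ t θ).im)
    {g : ℝ → ℝ} (hg : Continuous g) (hg0 : ∀ x, 0 ≤ g x)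
    {δ : ℝ} (hδ : 0 < δ) (hgδ : ∀ x ≤ 1 + δ, g x = 0) {t : ℝ} (ht : t ∈ Ioo 0 T) :
    0 ≤ weightedArea g H Hθ t := by
  obtain ⟨s, hs, hs'⟩ := ((eventually_weightedArea_eq_zero (Hθ := Hθ) hgt (ht.1.trans ht.2) hun hδ
    hgδ).and (Ioo_mem_nhdsGT ht.1)).exists
  rw [← hs]
  exact h.monotoneOn_weightedArea hgt hJ hg hg0 ⟨hs'.1, hs'.2.trans ht.2⟩ ht hs'.2.le

theorem continuous_arg_form (h : IsHarmonicStrip T H Ht Hθ Htt Htθ)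
    (hgt : ∀ t ∈ Ioo 0 T, ∀ θ, 1 < ‖H t θ‖ ^ 2) {t : ℝ} (ht : t ∈ Ioo 0 T) :
    Continuous fun θ => ((starRingEnd ℂ) (H t θ) * Hθ t θ).im / ‖H t θ‖ ^ 2 := by
  have h1 := h.cont.strip_slice ht
  have h2 := h.cont_θ.strip_slice ht
  refine Continuous.div (by fun_prop) (by fun_prop) fun θ => ?_
  have := hgt t ht θ
  positivity

/-- Take `g` to be a bump strictly between `1` and the minimum `μ` of `|H|²` on the curve. Its
primitive is then a constant `c > 0` on the curve, so the weighted area is `c` times the change of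
argument. Were this not positive, the weighted area would vanish for all earlier times, and the
Jacobian would vanish wherever `g(|H|²) > 0`, against density. -/
theorem integral_arg_form_pos (h : IsHarmonicStrip T H Ht Hθ Htt Htθ)
    (hgt : ∀ t ∈ Ioo 0 T, ∀ θ, 1 < ‖H t θ‖ ^ 2)
    (hun : ∀ δ > 0, ∀ᶠ t in 𝓝[>] 0, ∀ θ, ‖H t θ‖ ^ 2 ≤ 1 + δ)
    (hJ : ∀ t ∈ Ioo 0 T, ∀ θ, 0 ≤ ((starRingEnd ℂ) (Ht t θ) * Hθ t θ).im)
    (hdense : ∀ W : Set (ℝ × ℝ), IsOpen W → W ⊆ Ioo 0 T ×ˢ univ → W.Nonempty →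
      ∃ p ∈ W, ((starRingEnd ℂ) (Ht p.1 p.2) * Hθ p.1 p.2).im ≠ 0)
    {t : ℝ} (ht : t ∈ Ioo 0 T) :
    0 < ∫ θ in (0 : ℝ)..(2 * Real.pi), ((starRingEnd ℂ) (H t θ) * Hθ t θ).im / ‖H t θ‖ ^ 2 := by
  have hcH := h.cont.strip_slice ht
  obtain ⟨θ₀, hθ₀, hmin⟩ := (isCompact_Icc (a := 0) (b := 2 * Real.pi)).exists_isMinOn
    (nonempty_Icc.2 Real.two_pi_pos.le) (f := fun θ => ‖H t θ‖ ^ 2) (by fun_prop)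
  obtain ⟨μ, hμ⟩ : ∃ μ, μ = ‖H t θ₀‖ ^ 2 := ⟨_, rfl⟩
  have hμ1 : 1 < μ := hμ ▸ hgt t ht θ₀
  have hmin' : ∀ θ ∈ Icc 0 (2 * Real.pi), μ ≤ ‖H t θ‖ ^ 2 := fun θ hθ => hμ ▸ hmin hθ
  obtain ⟨δ, hδ, hδμ⟩ : ∃ δ > 0, 1 + δ < μ := ⟨(μ - 1) / 2, by linarith, by linarith⟩
  obtain ⟨g, hgdef⟩ : ∃ g : ℝ → ℝ, g = fun x => max 0 ((x - (1 + δ)) * (μ - x)) := ⟨_, rfl⟩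
  have hg : Continuous g := by rw [hgdef]; fun_prop
  have hg0 : ∀ x, 0 ≤ g x := fun x => by rw [hgdef]; exact le_max_left _ _
  have hgδ : ∀ x ≤ 1 + δ, g x = 0 := fun x hx => by
    rw [hgdef]; exact max_eq_left (mul_nonpos_of_nonpos_of_nonneg (by linarith) (by linarith))
  have hgμ : ∀ x, μ ≤ x → g x = 0 := fun x hx => by
    rw [hgdef]; exact max_eq_left (mul_nonpos_of_nonneg_of_nonpos (by linarith) (by linarith))
  have hgpos : ∀ x ∈ Ioo (1 + δ) μ, 0 < g x := fun x hx => by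
    rw [hgdef]; exact lt_max_of_lt_right (mul_pos (by linarith [hx.1]) (by linarith [hx.2]))
  obtain ⟨c, hc⟩ : ∃ c, c = ∫ x in (1 : ℝ)..μ, g x := ⟨_, rfl⟩
  have hc0 : 0 < c := by
    rw [hc]
    refine intervalIntegral.integral_pos hμ1 hg.continuousOn (fun x _ => hg0 x) ?_
    exact ⟨(1 + δ + μ) / 2, ⟨by linarith, by linarith⟩, hgpos _ ⟨by linarith, by linarith⟩⟩
  have hB : weightedArea g H Hθ t = c * ∫ θ in (0 : ℝ)..(2 * Real.pi),
      ((starRingEnd ℂ) (H t θ) * Hθ t θ).im / ‖H t θ‖ ^ 2 := by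
    rw [weightedArea, ← intervalIntegral.integral_const_mul]
    refine intervalIntegral.integral_congr fun θ hθ => ?_
    rw [uIcc_of_le Real.two_pi_pos.le] at hθ
    have : ∫ x in (1 : ℝ)..‖H t θ‖ ^ 2, g x = c := by
      rw [hc, ← intervalIntegral.integral_add_adjacent_intervals (hg.intervalIntegrable 1 μ)
        (hg.intervalIntegrable μ _), add_eq_left]
      refine intervalIntegral.integral_zero_ae (.of_forall fun x hx => hgμ x ?_)
      rw [uIoc_of_le (hmin' θ hθ)] at hx
      exact hx.1.le
    simp only [this]
    ring
  have hmono := h.monotoneOn_weightedArea hgt hJ hg hg0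
  have hnn := fun s hs => h.weightedArea_nonneg hgt hun hJ hg hg0 hδ hgδ (t := s) hs
  by_contra! hneg
  have hzero : ∀ s ∈ Ioo 0 t, weightedArea g H Hθ s = 0 := by
    intro s hs
    have hs' : s ∈ Ioo 0 T := ⟨hs.1, hs.2.trans ht.2⟩
    have h1 : weightedArea g H Hθ t ≤ 0 := by
      rw [hB]; exact mul_nonpos_of_nonneg_of_nonpos hc0.le hneg
    exact le_antisymm ((hmono hs' ht hs.2.le).trans h1) (hnn s hs')
  have hJ0 : ∀ s ∈ Ioo 0 t, ∀ θ ∈ Ioo 0 (2 * Real.pi), ‖H s θ‖ ^ 2 ∈ Ioo (1 + δ) μ →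
      ((starRingEnd ℂ) (Ht s θ) * Hθ s θ).im = 0 := by
    intro s hs θ hθ hm
    have hs' : s ∈ Ioo 0 T := ⟨hs.1, hs.2.trans ht.2⟩
    have hd := h.hasDerivAt_weightedArea hgt hg hs'
    have hd0 : HasDerivAt (weightedArea g H Hθ) 0 s :=
      (hasDerivAt_const s (0 : ℝ)).congr_of_eventuallyEq
        (Filter.eventually_of_mem (isOpen_Ioo.mem_nhds hs) hzero)
    have hi := hd.unique hd0
    by_contra hne
    have hpos : 0 < ((starRingEnd ℂ) (Ht s θ) * Hθ s θ).im := lt_of_le_of_ne (hJ s hs' θ) (Ne.symm hne)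
    have c1 := h.cont.strip_slice hs'
    have c2 := h.cont_t.strip_slice hs'
    have c3 := h.cont_θ.strip_slice hs'
    have := intervalIntegral.integral_pos (a := 0) (b := 2 * Real.pi) (f := fun θ =>
      2 * g (‖H s θ‖ ^ 2) * ((starRingEnd ℂ) (Ht s θ) * Hθ s θ).im) Real.two_pi_pos
      (Continuous.continuousOn (by fun_prop))
      (fun θ _ => mul_nonneg (mul_nonneg zero_le_two (hg0 _)) (hJ s hs' θ))
      ⟨θ, Ioo_subset_Icc_self hθ, mul_pos (mul_pos two_pos (hgpos _ hm)) hpos⟩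
    linarith
  obtain ⟨s₀, hs₀, hs₀'⟩ := ((hun δ hδ).and (Ioo_mem_nhdsGT ht.1)).exists
  have hsub : Icc s₀ t ⊆ Ioo 0 T := fun x hx => ⟨hs₀'.1.trans_le hx.1, hx.2.trans_lt ht.2⟩
  have hpi : Real.pi ∈ Ioo 0 (2 * Real.pi) := ⟨Real.pi_pos, by linarith [Real.pi_pos]⟩
  have hcs : ContinuousOn (fun s => ‖H s Real.pi‖ ^ 2) (Icc s₀ t) := by
    have := h.cont.comp (f := fun s : ℝ => (s, Real.pi)) (s := Icc s₀ t) (by fun_prop)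
      fun x hx => ⟨hsub hx, mem_univ _⟩
    exact this.norm.pow 2
  -- Along the ray `θ = π`, `|H|²` passes through the middle of `(1 + δ, μ)`; this makes the open
  -- set below nonempty.
  obtain ⟨s₁, hs₁, hs₁'⟩ := intermediate_value_Icc hs₀'.2.le hcs
    (⟨by linarith [hs₀ Real.pi], by linarith [hmin' _ (Ioo_subset_Icc_self hpi)]⟩ :
      (1 + δ + μ) / 2 ∈ Icc _ _)
  simp only at hs₁'
  have hs₁t : s₁ ≠ t := by
    rintro rfl
    linarith [hmin' _ (Ioo_subset_Icc_self hpi)]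
  have hO : IsOpen (Ioo 0 t ×ˢ Ioo 0 (2 * Real.pi) ∩ (fun p : ℝ × ℝ => ‖H p.1 p.2‖ ^ 2) ⁻¹' Ioo (1 + δ) μ) := by
    refine ContinuousOn.isOpen_inter_preimage ?_ (isOpen_Ioo.prod isOpen_Ioo) isOpen_Ioo
    exact (h.cont.norm.pow 2).mono fun p hp => ⟨⟨hp.1.1, hp.1.2.trans ht.2⟩, mem_univ _⟩
  obtain ⟨p, hp, hp'⟩ := hdense _ hO (fun p hp => ⟨⟨hp.1.1.1, hp.1.1.2.trans ht.2⟩, mem_univ _⟩)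
    ⟨(s₁, Real.pi), ⟨⟨hs₀'.1.trans_le hs₁.1, lt_of_le_of_ne hs₁.2 hs₁t⟩, hpi⟩,
      ⟨by simp only [hs₁']; linarith, by simp only [hs₁']; linarith⟩⟩
  exact hp' (hJ0 p.1 hp.1.1 p.2 hp.1.2 hp.2)

theorem integral_arg_form_ge (h : IsHarmonicStrip T H Ht Hθ Htt Htθ)
    (hgt : ∀ t ∈ Ioo 0 T, ∀ θ, 1 < ‖H t θ‖ ^ 2)
    (hun : ∀ δ > 0, ∀ᶠ t in 𝓝[>] 0, ∀ θ, ‖H t θ‖ ^ 2 ≤ 1 + δ)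
    (hJ : ∀ t ∈ Ioo 0 T, ∀ θ, 0 ≤ ((starRingEnd ℂ) (Ht t θ) * Hθ t θ).im)
    (hdense : ∀ W : Set (ℝ × ℝ), IsOpen W → W ⊆ Ioo 0 T ×ˢ univ → W.Nonempty →
      ∃ p ∈ W, ((starRingEnd ℂ) (Ht p.1 p.2) * Hθ p.1 p.2).im ≠ 0)
    {t : ℝ} (ht : t ∈ Ioo 0 T) :
    2 * Real.pi ≤ ∫ θ in (0 : ℝ)..(2 * Real.pi), ((starRingEnd ℂ) (H t θ) * Hθ t θ).im / ‖H t θ‖ ^ 2 := by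
  have hpos := h.integral_arg_form_pos hgt hun hJ hdense ht
  obtain ⟨n, hn⟩ := exists_int_integral_logDeriv (h.deriv_θ t ht) (h.cont_θ.strip_slice ht)
    (ne_zero_of_one_lt hgt t ht) (h.periodic t ht)
  rw [hn] at hpos ⊢
  have h1 : (0 : ℝ) < n := pos_of_mul_pos_right hpos Real.two_pi_pos.le
  have h2 : (1 : ℝ) ≤ n := by exact_mod_cast h1
  nlinarith [Real.two_pi_pos]

/-- With `φ` the angular speed, `Im (conj H * Hθ) = (|H|² - 1) φ + φ`. The second term integrates to
at least `2π`. The first has nonnegative integral: it is the limit of weighted areas as `g` tends to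
`1`. -/
theorem one_le_mean_area (h : IsHarmonicStrip T H Ht Hθ Htt Htθ)
    (hgt : ∀ t ∈ Ioo 0 T, ∀ θ, 1 < ‖H t θ‖ ^ 2)
    (hun : ∀ δ > 0, ∀ᶠ t in 𝓝[>] 0, ∀ θ, ‖H t θ‖ ^ 2 ≤ 1 + δ)
    (hJ : ∀ t ∈ Ioo 0 T, ∀ θ, 0 ≤ ((starRingEnd ℂ) (Ht t θ) * Hθ t θ).im)
    (hdense : ∀ W : Set (ℝ × ℝ), IsOpen W → W ⊆ Ioo 0 T ×ˢ univ → W.Nonempty →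
      ∃ p ∈ W, ((starRingEnd ℂ) (Ht p.1 p.2) * Hθ p.1 p.2).im ≠ 0)
    {t : ℝ} (ht : t ∈ Ioo 0 T) :
    1 ≤ periodMean fun θ => ((starRingEnd ℂ) (H t θ) * Hθ t θ).im := by
  obtain ⟨φ, hφ⟩ : ∃ φ : ℝ → ℝ, φ = fun θ => ((starRingEnd ℂ) (H t θ) * Hθ t θ).im / ‖H t θ‖ ^ 2 :=
    ⟨_, rfl⟩
  have hφc : Continuous φ := hφ ▸ h.continuous_arg_form hgt ht
  have hcH := h.cont.strip_slice ht
  have hN : 2 * Real.pi ≤ ∫ θ in (0 : ℝ)..(2 * Real.pi), φ θ := by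
    rw [hφ]; exact h.integral_arg_form_ge hgt hun hJ hdense ht
  have hA : ∀ θ, ((starRingEnd ℂ) (H t θ) * Hθ t θ).im = ‖H t θ‖ ^ 2 * φ θ := by
    intro θ
    have hne : ‖H t θ‖ ^ 2 ≠ 0 := (zero_lt_one.trans (hgt t ht θ)).ne'
    rw [hφ]
    simp only
    exact ((mul_comm _ _).trans (div_mul_cancel₀ _ hne)).symm
  have hi : ∀ {u : ℝ → ℝ}, Continuous u →
      IntervalIntegrable u MeasureTheory.volume 0 (2 * Real.pi) := fun hu => hu.intervalIntegrable _ _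
  have key : ∀ δ > 0, -(2 * δ * ∫ θ in (0 : ℝ)..(2 * Real.pi), |φ θ|) ≤
      ∫ θ in (0 : ℝ)..(2 * Real.pi), (‖H t θ‖ ^ 2 - 1) * φ θ := by
    intro δ hδ
    -- A ramp from `0` at `1 + δ` to `1` at `1 + 2δ`; its primitive differs from `y - 1` by at most
    -- `2δ`.
    obtain ⟨g, hgdef⟩ : ∃ g : ℝ → ℝ, g = fun x => min 1 (max 0 ((x - (1 + δ)) / δ)) := ⟨_, rfl⟩
    have hg : Continuous g := by rw [hgdef]; fun_prop
    have hg0 : ∀ x, 0 ≤ g x := fun x => by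
      rw [hgdef]; exact le_min zero_le_one (le_max_left _ _)
    have hg1 : ∀ x, g x ≤ 1 := fun x => by rw [hgdef]; exact min_le_left _ _
    have hgδ : ∀ x ≤ 1 + δ, g x = 0 := fun x hx => by
      rw [hgdef]
      simp only
      rw [max_eq_left (div_nonpos_of_nonpos_of_nonneg (by linarith) hδ.le), min_eq_right zero_le_one]
    have hg2 : ∀ x, 1 + 2 * δ ≤ x → g x = 1 := fun x hx => by
      rw [hgdef]
      exact min_eq_left (le_max_of_le_right ((one_le_div hδ).2 (by linarith)))
    have hB := h.weightedArea_nonneg hgt hun hJ hg hg0 hδ hgδ ht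
    have hG : ∀ y, 1 ≤ y → |(∫ x in (1 : ℝ)..y, g x) - (y - 1)| ≤ 2 * δ := by
      intro y hy
      have hI := fun a b => hg.intervalIntegrable (μ := MeasureTheory.volume) a b
      have e1 : ∫ x in (1 : ℝ)..y, g x ≤ y - 1 := by
        have := intervalIntegral.integral_mono_on hy (hI _ _) intervalIntegrable_const (fun x _ => hg1 x)
        simpa using this
      have e2 : y - 1 - 2 * δ ≤ ∫ x in (1 : ℝ)..y, g x := by
        rcases le_total y (1 + 2 * δ) with hy2 | hy2
        · have := intervalIntegral.integral_nonneg (μ := MeasureTheory.volume) hy (fun x _ => hg0 x)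
          linarith
        · rw [← intervalIntegral.integral_add_adjacent_intervals (hI 1 (1 + 2 * δ)) (hI _ _)]
          have e3 := intervalIntegral.integral_nonneg (μ := MeasureTheory.volume)
            (by linarith : 1 ≤ 1 + 2 * δ) (fun x _ => hg0 x)
          have e4 : ∫ x in (1 + 2 * δ)..y, g x = ∫ x in (1 + 2 * δ)..y, (1 : ℝ) := by
            refine intervalIntegral.integral_congr fun x hx => hg2 x ?_
            rw [uIcc_of_le hy2] at hx
            exact hx.1
          rw [e4]
          simp
          linarith
      rw [abs_le]
      constructor <;> linarith
    have hGc : Continuous fun θ => ∫ x in (1 : ℝ)..‖H t θ‖ ^ 2, g x :=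
      (intervalIntegral.continuous_primitive (fun a b => hg.intervalIntegrable a b) 1).comp
        (by fun_prop : Continuous fun θ => ‖H t θ‖ ^ 2)
    have hB' : weightedArea g H Hθ t =
        ∫ θ in (0 : ℝ)..(2 * Real.pi), (∫ x in (1 : ℝ)..‖H t θ‖ ^ 2, g x) * φ θ := by
      rw [weightedArea, hφ]
      congr 1
      ext θ
      ring
    rw [hB'] at hB
    rw [neg_le_iff_add_nonneg, ← intervalIntegral.integral_const_mul,
      ← intervalIntegral.integral_add (hi (by fun_prop)) (hi (by fun_prop))]
    refine hB.trans (intervalIntegral.integral_mono_on Real.two_pi_pos.le (hi (by fun_prop))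
      (hi (by fun_prop)) fun θ _ => ?_)
    have e1 := hG _ (hgt t ht θ).le
    have e2 := mul_le_mul_of_nonneg_right e1 (abs_nonneg (φ θ))
    rw [← abs_mul] at e2
    have e3 := (le_abs_self _).trans e2
    linarith
  have hge : 0 ≤ ∫ θ in (0 : ℝ)..(2 * Real.pi), (‖H t θ‖ ^ 2 - 1) * φ θ := by
    have hlim : Tendsto (fun δ : ℝ => -(2 * δ * ∫ θ in (0 : ℝ)..(2 * Real.pi), |φ θ|)) (𝓝[>] 0) (𝓝 0) := by
      have : Continuous (fun δ : ℝ => -(2 * δ * ∫ θ in (0 : ℝ)..(2 * Real.pi), |φ θ|)) := by fun_prop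
      simpa using (this.tendsto 0).mono_left nhdsWithin_le_nhds
    exact le_of_tendsto hlim (eventually_nhdsWithin_of_forall key)
  have hsum : ∫ θ in (0 : ℝ)..(2 * Real.pi), ((starRingEnd ℂ) (H t θ) * Hθ t θ).im =
      (∫ θ in (0 : ℝ)..(2 * Real.pi), (‖H t θ‖ ^ 2 - 1) * φ θ) + ∫ θ in (0 : ℝ)..(2 * Real.pi), φ θ := by
    rw [← intervalIntegral.integral_add (hi (by fun_prop)) (hi hφc)]
    congr 1
    ext θ
    rw [hA]; ring
  rw [periodMean, hsum, inv_mul_eq_div, one_le_div Real.two_pi_pos]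
  linarith

end IsHarmonicStrip

/-! ### Local degree and the sign of the Jacobian. -/

theorem exp_mul_I_eq_one_mem_zmultiples {x : ℝ} (hx : Complex.exp (x * Complex.I) = 1) :
    x ∈ AddSubgroup.zmultiples (2 * Real.pi) := by
  obtain ⟨n, hn⟩ := Complex.exp_eq_one_iff.1 hx
  refine ⟨n, ?_⟩
  have h1 : (x : ℂ) = n * (2 * Real.pi) := by
    apply mul_right_cancel₀ Complex.I_ne_zero
    rw [hn]; ring
  simp only [zsmul_eq_mul]
  exact_mod_cast h1.symm

/-- Since `w` stays in the unit disk about `1`, its principal argument is continuous. Hence `φ t + t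
- arg b - arg (w t)` is continuous with values in `2πℤ`, so constant. -/
theorem HasWindingNumber.eq_neg_one {γ w : ℝ → ℂ} {b : ℂ} {n : ℤ} (hγ : HasWindingNumber γ n)
    (hb : b ≠ 0) (hw : ContinuousOn w (Icc 0 (2 * Real.pi)))
    (hw1 : ∀ t ∈ Icc 0 (2 * Real.pi), ‖w t - 1‖ < 1)
    (hγw : ∀ t, γ t = b * Complex.exp (-(t * Complex.I)) * w t)
    (hper : w (2 * Real.pi) = w 0) : n = -1 := by
  obtain ⟨-, φ, hφ, hφγ, hφn⟩ := hγ
  have hpi := Real.two_pi_pos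
  have hslit : ∀ t ∈ Icc 0 (2 * Real.pi), w t ∈ Complex.slitPlane := by
    intro t ht
    refine Or.inl ?_
    have h1 := (abs_le.1 (Complex.abs_re_le_norm (w t - 1))).1
    have h2 := hw1 t ht
    simp only [Complex.sub_re, Complex.one_re] at h1
    linarith
  have hψc : ContinuousOn (fun t => φ t + t - b.arg - (w t).arg) (Icc 0 (2 * Real.pi)) :=
    ((hφ.add continuousOn_id).sub continuousOn_const).sub fun t ht =>
      (Complex.continuousAt_arg (hslit t ht)).comp_continuousWithinAt (hw t ht)
  have hψ : MapsTo (fun t => φ t + t - b.arg - (w t).arg) (Icc 0 (2 * Real.pi))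
      (AddSubgroup.zmultiples (2 * Real.pi)) := by
    intro t ht
    refine exp_mul_I_eq_one_mem_zmultiples ?_
    have hw0 : w t ≠ 0 := Complex.slitPlane_ne_zero (hslit t ht)
    have e1 := hφγ t ht
    have e2 := Complex.norm_mul_exp_arg_mul_I b
    have e3 := Complex.norm_mul_exp_arg_mul_I (w t)
    have hn : ‖γ t‖ = ‖b‖ * ‖w t‖ := by
      rw [hγw t, norm_mul, norm_mul]
      have : -((t : ℂ) * Complex.I) = ((-t : ℝ) : ℂ) * Complex.I := by push_cast; ring
      rw [this, Complex.norm_exp_ofReal_mul_I, mul_one]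
    rw [hn, hγw t] at e1
    have hb' : (‖b‖ : ℂ) ≠ 0 := by exact_mod_cast norm_ne_zero_iff.2 hb
    have hw' : (‖w t‖ : ℂ) ≠ 0 := by exact_mod_cast norm_ne_zero_iff.2 hw0
    have e4 : Complex.exp (((φ t + t - b.arg - (w t).arg : ℝ) : ℂ) * Complex.I) =
        Complex.exp (φ t * Complex.I) * Complex.exp (t * Complex.I) /
          (Complex.exp (b.arg * Complex.I) * Complex.exp ((w t).arg * Complex.I)) := by
      rw [← Complex.exp_add, ← Complex.exp_add, ← Complex.exp_sub]
      congr 1; push_cast; ring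
    rw [e4, div_eq_one_iff_eq (by simp)]
    have e5 : Complex.exp (-(t * Complex.I)) * Complex.exp (t * Complex.I) = 1 := by
      rw [← Complex.exp_add]; simp
    apply mul_left_cancel₀ (mul_ne_zero hb' hw')
    push_cast at e1
    linear_combination -Complex.exp (t * Complex.I) * e1 + b * w t * e5 -
      (‖w t‖ * Complex.exp ((w t).arg * Complex.I)) * e2 - b * e3
  have hconst := isPreconnected_Icc.constant_of_mapsTo
    (SetLike.isDiscrete_iff_discreteTopology.2 inferInstance) hψc hψ
    (right_mem_Icc.2 hpi.le) (left_mem_Icc.2 hpi.le)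
  simp only [hper] at hconst
  have h3 : 2 * Real.pi * ((n : ℝ) + 1) = 0 := by linarith
  have h4 : (n : ℝ) + 1 = 0 := by
    rcases mul_eq_zero.1 h3 with h | h
    · linarith
    · exact h
  have : n + 1 = 0 := by exact_mod_cast h4
  omega

theorem clm_apply_eq_wirtinger (L : ℂ →L[ℝ] ℂ) (v : ℂ) :
    L v = (L 1 - Complex.I * L Complex.I) / 2 * v +
      (L 1 + Complex.I * L Complex.I) / 2 * (starRingEnd ℂ) v := by
  have h : L v = v.re * L 1 + v.im * L Complex.I := by
    conv_lhs => rw [← Complex.re_add_im v]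
    have h1 : (v.re : ℂ) = v.re • (1 : ℂ) := by simp
    have h2 : (v.im : ℂ) * Complex.I = v.im • Complex.I := by simp
    rw [map_add, h2, L.map_smul, h1, L.map_smul]
    simp
  rw [h]
  conv_rhs => rw [← Complex.re_add_im v]
  simp only [map_add, map_mul, Complex.conj_ofReal, Complex.conj_I]
  linear_combination ((v.im : ℂ) * L Complex.I) * Complex.I_sq

theorem im_conj_mul_eq_normSq_sub (P Q : ℂ) :
    ((starRingEnd ℂ) P * Q).im = ‖(P - Complex.I * Q) / 2‖ ^ 2 - ‖(P + Complex.I * Q) / 2‖ ^ 2 := by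
  rw [Complex.sq_norm, Complex.sq_norm, Complex.normSq_apply, Complex.normSq_apply]
  simp
  ring

/-- Write the differential as `α v + β conj v`; the Jacobian is `|α|² - |β|²`. If it is negative,
the term `β conj v` dominates on small circles and the winding number is `-1`. -/
theorem im_conj_fderiv_nonneg {h : ℂ → ℂ} {z : ℂ} (hd : DifferentiableAt ℝ h z)
    (hc : ∀ᶠ x in 𝓝 z, ContinuousAt h x)
    (hw : ∀ᶠ r in 𝓝[>] (0 : ℝ), HasWindingNumber (fun t : ℝ => h (circleMap z r t) - h z) 1) :
    0 ≤ ((starRingEnd ℂ) (fderiv ℝ h z 1) * fderiv ℝ h z Complex.I).im := by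
  by_contra! hneg
  obtain ⟨L, hL⟩ : ∃ L, L = fderiv ℝ h z := ⟨_, rfl⟩
  obtain ⟨α, hα⟩ : ∃ α, α = (L 1 - Complex.I * L Complex.I) / 2 := ⟨_, rfl⟩
  obtain ⟨β, hβ⟩ : ∃ β, β = (L 1 + Complex.I * L Complex.I) / 2 := ⟨_, rfl⟩
  have hLv : ∀ v, L v = α * v + β * (starRingEnd ℂ) v := fun v => by
    rw [hα, hβ]; exact clm_apply_eq_wirtinger L v
  rw [im_conj_mul_eq_normSq_sub, ← hL, ← hα, ← hβ] at hneg
  have hαβ : ‖α‖ < ‖β‖ := lt_of_pow_lt_pow_left₀ 2 (norm_nonneg _) (by linarith)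
  have hβ0 : 0 < ‖β‖ := (norm_nonneg _).trans_lt hαβ
  have hβ0' : β ≠ 0 := norm_pos_iff.1 hβ0
  -- This tolerance keeps the linearisation error plus `‖α‖ r` strictly below `‖β‖ r`.
  have ho := (hasFDerivAt_iff_isLittleO_nhds_zero.1 hd.hasFDerivAt).def
    (c := (‖β‖ - ‖α‖) / 2) (by linarith)
  rw [← hL] at ho
  obtain ⟨ρ, hρ, hρo⟩ := Metric.eventually_nhds_iff.1 ho
  obtain ⟨ρ', hρ', hρc⟩ := Metric.eventually_nhds_iff.1 hc
  obtain ⟨r, hr, hr'⟩ := (hw.and (Ioo_mem_nhdsGT (lt_min hρ hρ'))).exists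
  have hr0 : 0 < r := hr'.1
  have hrc : (r : ℂ) ≠ 0 := by exact_mod_cast hr0.ne'
  have hE : ∀ t : ℝ, Complex.exp (-(t * Complex.I)) * Complex.exp (t * Complex.I) = 1 := fun t => by
    rw [← Complex.exp_add]; simp
  have hnE : ∀ t : ℝ, ‖Complex.exp (t * Complex.I)‖ = 1 := Complex.norm_exp_ofReal_mul_I
  have hconj : ∀ t : ℝ, (starRingEnd ℂ) (Complex.exp (t * Complex.I)) = Complex.exp (-(t * Complex.I)) := by
    intro t; rw [← Complex.exp_conj]; simp
  have hnum := hr.eq_neg_one (b := r * β)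
    (w := fun t => (h (circleMap z r t) - h z) * Complex.exp (t * Complex.I) / (r * β))
    (mul_ne_zero hrc hβ0') ?_ ?_ ?_ ?_
  · norm_num at hnum
  · intro t _
    have hcirc : ContinuousAt h (circleMap z r t) := by
      refine hρc ?_
      rw [dist_eq_norm, circleMap_sub_center, norm_circleMap_zero, abs_of_pos hr0]
      exact hr'.2.trans_le (min_le_right _ _)
    have h1 : ContinuousAt (fun t => h (circleMap z r t)) t :=
      hcirc.comp (f := circleMap z r) (continuous_circleMap z r).continuousAt
    exact (((h1.sub continuousAt_const).mul
      (by fun_prop)).div_const _).continuousWithinAt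
  · intro t _
    obtain ⟨v, hv⟩ : ∃ v, v = r * Complex.exp (t * Complex.I) := ⟨_, rfl⟩
    have hzv : circleMap z r t = z + v := by rw [hv, circleMap]
    have hnv : ‖v‖ = r := by rw [hv, norm_mul, hnE, mul_one, Complex.norm_real, Real.norm_of_nonneg hr0.le]
    have ho := hρo (y := v) (by rw [dist_zero_right, hnv]; exact hr'.2.trans_le (min_le_left _ _))
    rw [hzv]
    have e1 : (h (z + v) - h z) * Complex.exp (t * Complex.I) / (r * β) - 1 =
        ((h (z + v) - h z - L v) + α * v) * Complex.exp (t * Complex.I) / (r * β) := by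
      have : β * (starRingEnd ℂ) v * Complex.exp (t * Complex.I) = r * β := by
        rw [hv, map_mul, Complex.conj_ofReal, hconj]
        linear_combination β * r * hE t
      have hne : (r : ℂ) * β ≠ 0 := mul_ne_zero hrc hβ0'
      rw [hLv v]
      field_simp
      linear_combination this
    rw [e1, norm_div, norm_mul, hnE, mul_one, norm_mul, Complex.norm_real, Real.norm_of_nonneg hr0.le,
      div_lt_one (by positivity)]
    calc _ ≤ ‖h (z + v) - h z - L v‖ + ‖α * v‖ := norm_add_le _ _
      _ ≤ (‖β‖ - ‖α‖) / 2 * r + ‖α‖ * r := by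
          rw [norm_mul, hnv]; rw [hnv] at ho; gcongr
      _ < r * ‖β‖ := by nlinarith
  · intro t
    have hne : (r : ℂ) * β ≠ 0 := mul_ne_zero hrc hβ0'
    field_simp
    linear_combination -(h (circleMap z r t) - h z) * hE t
  · have e1 : circleMap z r (2 * Real.pi) = circleMap z r 0 := by
      simpa using periodic_circleMap z r 0
    have e2 : Complex.exp (((2 * Real.pi : ℝ) : ℂ) * Complex.I) = Complex.exp (((0 : ℝ) : ℂ) * Complex.I) := by
      push_cast; rw [Complex.exp_two_pi_mul_I]; simp
    simp only [e1, e2]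

theorem det_eq_im_conj_mul (L : ℂ →L[ℝ] ℂ) :
    L.det = ((starRingEnd ℂ) (L 1) * L Complex.I).im := by
  rw [ContinuousLinearMap.det, ← LinearMap.det_toMatrix Complex.basisOneI, Matrix.det_fin_two]
  simp [LinearMap.toMatrix_apply]
  ring

/-! ### Application to harmonic homeomorphisms of the annulus. -/

theorem isOpen_roundAnnulus (R : ℝ) : IsOpen (roundAnnulus R) :=
  (isOpen_lt continuous_const continuous_norm).inter (isOpen_lt continuous_norm continuous_const)

theorem norm_exp_stripPt (t θ : ℝ) : ‖Complex.exp (stripPt t θ)‖ = Real.exp t := by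
  rw [Complex.norm_exp]; simp [stripPt]

theorem exp_stripPt (t θ : ℝ) : Complex.exp (stripPt t θ) = circleMap 0 (Real.exp t) θ := by
  rw [circleMap, stripPt, Complex.exp_add]; simp

theorem exp_mem_roundAnnulus {R : ℝ} (hR : 0 < R) {w : ℂ} (h0 : 0 < w.re) (h1 : w.re < Real.log R) :
    Complex.exp w ∈ roundAnnulus R := by
  rw [roundAnnulus, mem_ofPred_eq, Complex.norm_exp]
  exact ⟨Real.one_lt_exp_iff.2 h0, (Real.lt_log_iff_exp_lt hR).1 h1⟩

theorem isOpenMap_stripPt : IsOpenMap fun p : ℝ × ℝ => stripPt p.1 p.2 := by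
  have : (fun p : ℝ × ℝ => stripPt p.1 p.2) = Complex.equivRealProdCLM.symm := by
    ext p
    simp [stripPt, Complex.equivRealProdCLM_symm_apply]
  rw [this]
  exact Complex.equivRealProdCLM.symm.toHomeomorph.isOpenMap

theorem fderiv_comp_exp {h : ℂ → ℂ} {w : ℂ} (hd : DifferentiableAt ℝ h (Complex.exp w)) (v : ℂ) :
    fderiv ℝ (fun w => h (Complex.exp w)) w v = fderiv ℝ h (Complex.exp w) (Complex.exp w * v) := by
  have h1 : HasFDerivAt Complex.exp _ w := (Complex.hasDerivAt_exp w).hasFDerivAt.restrictScalars ℝ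
  have h2 : HasFDerivAt (fun w => h (Complex.exp w)) _ w := hd.hasFDerivAt.comp w h1
  rw [h2.fderiv]
  simp [mul_comm]

theorem im_conj_clm_mul_right (L : ℂ →L[ℝ] ℂ) (a : ℂ) :
    ((starRingEnd ℂ) (L (a * 1)) * L (a * Complex.I)).im =
      ‖a‖ ^ 2 * ((starRingEnd ℂ) (L 1) * L Complex.I).im := by
  rw [clm_apply_eq_wirtinger L (a * 1), clm_apply_eq_wirtinger L (a * Complex.I),
    im_conj_mul_eq_normSq_sub (L 1), Complex.sq_norm, Complex.sq_norm, Complex.sq_norm]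
  generalize (L 1 - Complex.I * L Complex.I) / 2 = α
  generalize (L 1 + Complex.I * L Complex.I) / 2 = β
  simp only [Complex.normSq_apply, map_mul, mul_one, Complex.conj_I, Complex.add_re,
    Complex.add_im, Complex.mul_re, Complex.mul_im, Complex.conj_re, Complex.conj_im, Complex.I_re,
    Complex.I_im, Complex.neg_re, Complex.neg_im]
  ring

namespace IsHarmonicHomeo

variable {R : ℝ} {D : Set ℂ} {h : ℂ → ℂ}

theorem one_lt_norm_sq (hD : IsHalfRoundAnnulus D) (hh : IsHarmonicHomeo R D h) {z : ℂ}
    (hz : z ∈ roundAnnulus R) : 1 < ‖h z‖ ^ 2 := by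
  obtain ⟨G, -, -, -, -, hG⟩ := hD.compl_eq
  have h1 : h z ∈ D := hh.image_eq ▸ mem_image_of_mem h hz
  by_contra! hle
  have h2 : h z ∈ Metric.closedBall (0 : ℂ) 1 := by
    rw [mem_closedBall_zero_iff]
    exact (sq_le_one_iff₀ (norm_nonneg _)).1 hle
  have h3 : ((h z : ℂ) : OnePoint ℂ) ∈ ((fun z : ℂ => (z : OnePoint ℂ)) '' D)ᶜ := by
    rw [hG]
    exact Or.inl (mem_image_of_mem _ h2)
  exact h3 (mem_image_of_mem _ h1)

/-- Compactness of the Riemann sphere: otherwise `h` would have a cluster point at the inner circle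
outside the disk `‖w‖² < 1 + δ`. -/
theorem eventually_norm_sq_le (hh : IsHarmonicHomeo R D h) {δ : ℝ} (hδ : 0 < δ) :
    ∀ᶠ z in comap (fun z : ℂ => ‖z‖) (𝓝[>] 1), ‖h z‖ ^ 2 ≤ 1 + δ := by
  by_contra hcon
  have hfr := not_eventually.1 hcon
  have hopen : IsOpen ((fun z : ℂ => (z : OnePoint ℂ)) '' {w : ℂ | ‖w‖ ^ 2 < 1 + δ}) :=
    OnePoint.isOpen_image_coe.2 (isOpen_lt (by fun_prop) continuous_const)
  obtain ⟨a, ha, hcl⟩ := hopen.isClosed_compl.isCompact.exists_mapClusterPt_of_frequently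
    (l := comap (fun z : ℂ => ‖z‖) (𝓝[>] 1)) (f := fun z => (h z : OnePoint ℂ)) (hfr.mono fun z hz => by
      rintro ⟨w, hw, hwz⟩
      rw [OnePoint.coe_injective hwz] at hw
      exact hz (le_of_lt hw))
  have hmem : a ∈ innerClusterSet h := hcl
  rw [hh.innerClusterSet_eq] at hmem
  obtain ⟨u, hu, rfl⟩ := hmem
  refine ha (mem_image_of_mem _ ?_)
  rw [mem_sphere_zero_iff_norm] at hu
  rw [mem_ofPred_eq, hu]
  linarith

theorem isOpen_image (hD : IsHalfRoundAnnulus D) (hh : IsHarmonicHomeo R D h) {E : Set ℂ}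
    (hE : IsOpen E) (hER : E ⊆ roundAnnulus R) : IsOpen (h '' E) := by
  have hr : range ((roundAnnulus R).domRestrict h) = D := by
    rw [← hh.image_eq]
    ext w
    simp
  have ho : IsOpenEmbedding ((roundAnnulus R).domRestrict h) :=
    ⟨hh.isEmbedding, hr ▸ hD.isOpen⟩
  have h1 := ho.isOpenMap _ (hE.preimage continuous_subtype_val)
  convert h1 using 1
  ext w
  constructor
  · rintro ⟨z, hz, rfl⟩
    exact ⟨⟨z, hER hz⟩, hz, rfl⟩
  · rintro ⟨z, hz, rfl⟩
    exact ⟨z, hz, rfl⟩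

/-- If the Jacobian vanished throughout `E`, Sard's theorem would make `h '' E` a null set, but it
is open and nonempty. -/
theorem exists_jacobian_ne_zero (hD : IsHalfRoundAnnulus D) (hh : IsHarmonicHomeo R D h) {E : Set ℂ}
    (hE : IsOpen E) (hER : E ⊆ roundAnnulus R) (hne : E.Nonempty) :
    ∃ z ∈ E, ((starRingEnd ℂ) (fderiv ℝ h z 1) * fderiv ℝ h z Complex.I).im ≠ 0 := by
  by_contra! hcon
  have h1 := MeasureTheory.addHaar_image_eq_zero_of_det_fderivWithin_eq_zero MeasureTheory.volume
    (f := h) (s := E) (f' := fun z => fderiv ℝ h z)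
    (fun z hz => ((hh.harmonic z (hER hz)).1.differentiableAt (by norm_num)).hasFDerivAt.hasFDerivWithinAt)
    (fun z hz => by rw [det_eq_im_conj_mul]; exact hcon z hz)
  exact ((hh.isOpen_image hD hE hER).measure_pos MeasureTheory.volume (hne.image h)).ne' h1

theorem jacobian_nonneg (hh : IsHarmonicHomeo R D h) {z : ℂ} (hz : z ∈ roundAnnulus R) :
    0 ≤ ((starRingEnd ℂ) (fderiv ℝ h z 1) * fderiv ℝ h z Complex.I).im := by
  refine im_conj_fderiv_nonneg ((hh.harmonic z hz).1.differentiableAt (by norm_num)) ?_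
    (hh.orientation z hz)
  filter_upwards [(isOpen_roundAnnulus R).mem_nhds hz] with x hx
  exact (hh.harmonic x hx).1.continuousAt

theorem circleAverage_bounds (hR : 1 < R) (hmod : Real.log R ≤ 3 / 2) (hD : IsHalfRoundAnnulus D)
    (hh : IsHarmonicHomeo R D h) :
    MonotoneOn (fun ρ => Real.circleAverage (fun z => ‖h z‖ ^ 2) 0 ρ) (Ioo 1 R) ∧
      ∀ ρ ∈ Ioo 1 R, (1 / 2 * (ρ + 1 / ρ)) ^ 2 ≤ Real.circleAverage (fun z => ‖h z‖ ^ 2) 0 ρ := by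
  have hR0 : 0 < R := by linarith
  have hT : 0 < Real.log R := Real.log_pos hR
  have hmem : ∀ t ∈ Ioo 0 (Real.log R), ∀ θ, Complex.exp (stripPt t θ) ∈ roundAnnulus R := by
    intro t ht θ
    exact exp_mem_roundAnnulus hR0 (by simpa [stripPt] using ht.1) (by simpa [stripPt] using ht.2)
  have hS := isHarmonicStrip_of_harmonicOnNhd (T := Real.log R) (K := fun w => h (Complex.exp w))
    (fun w hw => HarmonicAt.comp_analyticAt_complex
      (hh.harmonic _ (exp_mem_roundAnnulus hR0 hw.1 hw.2)) analyticAt_cexp)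
    (fun w => by rw [Complex.exp_periodic w])
  have hgt : ∀ t ∈ Ioo 0 (Real.log R), ∀ θ, 1 < ‖h (Complex.exp (stripPt t θ))‖ ^ 2 :=
    fun t ht θ => hh.one_lt_norm_sq hD (hmem t ht θ)
  have hun : ∀ δ > 0, ∀ᶠ t in 𝓝[>] 0, ∀ θ, ‖h (Complex.exp (stripPt t θ))‖ ^ 2 ≤ 1 + δ := by
    intro δ hδ
    have h1 := eventually_comap.1 (hh.eventually_norm_sq_le hδ)
    have h2 : Tendsto Real.exp (𝓝[>] 0) (𝓝[>] 1) := by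
      refine tendsto_nhdsWithin_iff.2 ⟨?_, ?_⟩
      · simpa using (Real.continuous_exp.tendsto 0).mono_left nhdsWithin_le_nhds
      · exact eventually_nhdsWithin_of_forall fun t ht => Real.one_lt_exp_iff.2 ht
    filter_upwards [h2.eventually h1] with t ht θ
    exact ht _ (norm_exp_stripPt t θ)
  have hJac : ∀ t ∈ Ioo 0 (Real.log R), ∀ θ,
      ((starRingEnd ℂ) (fderiv ℝ (fun w => h (Complex.exp w)) (stripPt t θ) 1) *
        fderiv ℝ (fun w => h (Complex.exp w)) (stripPt t θ) Complex.I).im =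
      ‖Complex.exp (stripPt t θ)‖ ^ 2 *
        ((starRingEnd ℂ) (fderiv ℝ h (Complex.exp (stripPt t θ)) 1) *
          fderiv ℝ h (Complex.exp (stripPt t θ)) Complex.I).im := by
    intro t ht θ
    have hd := (hh.harmonic _ (hmem t ht θ)).1.differentiableAt (by norm_num)
    rw [fderiv_comp_exp hd, fderiv_comp_exp hd, im_conj_clm_mul_right]
  have hJ : ∀ t ∈ Ioo 0 (Real.log R), ∀ θ,
      0 ≤ ((starRingEnd ℂ) (fderiv ℝ (fun w => h (Complex.exp w)) (stripPt t θ) 1) *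
        fderiv ℝ (fun w => h (Complex.exp w)) (stripPt t θ) Complex.I).im := by
    intro t ht θ
    rw [hJac t ht θ]
    exact mul_nonneg (sq_nonneg _) (hh.jacobian_nonneg (hmem t ht θ))
  have hdense : ∀ W : Set (ℝ × ℝ), IsOpen W → W ⊆ Ioo 0 (Real.log R) ×ˢ univ → W.Nonempty →
      ∃ p ∈ W, ((starRingEnd ℂ) (fderiv ℝ (fun w => h (Complex.exp w)) (stripPt p.1 p.2) 1) *
        fderiv ℝ (fun w => h (Complex.exp w)) (stripPt p.1 p.2) Complex.I).im ≠ 0 := by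
    intro W hW hWT hWne
    obtain ⟨z, ⟨p, hp, rfl⟩, hz⟩ := hh.exists_jacobian_ne_zero hD
      ((Complex.isOpenMap_exp.comp isOpenMap_stripPt) W hW)
      (by rintro _ ⟨p, hp, rfl⟩; exact hmem p.1 (hWT hp).1 p.2) (hWne.image _)
    refine ⟨p, hp, ?_⟩
    rw [hJac p.1 (hWT hp).1 p.2]
    exact mul_ne_zero (pow_ne_zero 2 (norm_ne_zero_iff.2 (Complex.exp_ne_zero _))) hz
  have hcont := fun t (ht : t ∈ Ioo 0 (Real.log R)) => hS.cont.strip_slice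
    (f := fun t θ => h (Complex.exp (stripPt t θ))) ht
  have hge : ∀ t ∈ Ioo 0 (Real.log R),
      1 ≤ periodMean fun θ => ‖h (Complex.exp (stripPt t θ))‖ ^ 2 := by
    intro t ht
    have hc := hcont t ht
    have := intervalIntegral.integral_mono_on Real.two_pi_pos.le
      (intervalIntegrable_const (c := (1 : ℝ)) (μ := MeasureTheory.volume))
      (Continuous.intervalIntegrable (hc.norm.pow 2) _ _) (fun θ _ => (hgt t ht θ).le)
    simp only [intervalIntegral.integral_const, sub_zero, smul_eq_mul, mul_one] at this
    rw [periodMean, inv_mul_eq_div, one_le_div Real.two_pi_pos]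
    exact this
  have hlim : Tendsto (fun t => periodMean fun θ => ‖h (Complex.exp (stripPt t θ))‖ ^ 2)
      (𝓝[>] 0) (𝓝 1) := by
    refine tendsto_order.2 ⟨fun a ha => ?_, fun a ha => ?_⟩
    · filter_upwards [Ioo_mem_nhdsGT hT] with t ht
      exact ha.trans_le (hge t ht)
    · obtain ⟨b, hb1, hba⟩ := exists_between ha
      filter_upwards [Ioo_mem_nhdsGT hT, hun (b - 1) (by linarith)] with t ht htb
      have hc := hcont t ht
      have := intervalIntegral.integral_mono_on Real.two_pi_pos.le
        (Continuous.intervalIntegrable (hc.norm.pow 2) _ _)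
        (intervalIntegrable_const (c := 1 + (b - 1)) (μ := MeasureTheory.volume)) (fun θ _ => htb θ)
      simp only [intervalIntegral.integral_const, sub_zero, smul_eq_mul] at this
      refine lt_of_le_of_lt ?_ hba
      rw [periodMean, inv_mul_eq_div, div_le_iff₀ Real.two_pi_pos]
      calc _ ≤ _ := this
        _ = b * (2 * Real.pi) := by ring
  have hmean : ∀ t, (periodMean fun θ => ‖h (Complex.exp (stripPt t θ))‖ ^ 2) =
      Real.circleAverage (fun z => ‖h z‖ ^ 2) 0 (Real.exp t) := by
    intro t
    simp only [periodMean, Real.circleAverage, exp_stripPt, smul_eq_mul]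
  have hlog : ∀ ρ ∈ Ioo 1 R, Real.log ρ ∈ Ioo 0 (Real.log R) := fun ρ hρ =>
    ⟨Real.log_pos hρ.1, Real.log_lt_log (by linarith [hρ.1]) hρ.2⟩
  have hexp : ∀ ρ ∈ Ioo 1 R, Real.exp (Real.log ρ) = ρ := fun ρ hρ =>
    Real.exp_log (by linarith [hρ.1])
  have hmono : MonotoneOn (fun t => periodMean fun θ => ‖h (Complex.exp (stripPt t θ))‖ ^ 2)
      (Ioo 0 (Real.log R)) := by
    refine monotoneOn_of_deriv_nonneg (convex_Ioo 0 _)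
      (fun x hx => (hS.hasDerivAt_mean_sq hx).continuousAt.continuousWithinAt)
      (fun x hx => (hS.hasDerivAt_mean_sq (interior_subset hx)).differentiableAt.differentiableWithinAt)
      (fun x hx => ?_)
    rw [(hS.hasDerivAt_mean_sq (interior_subset hx)).deriv]
    exact mul_nonneg zero_le_two (hS.mean_t_nonneg hlim hge (interior_subset hx))
  constructor
  · intro ρ hρ σ hσ hρσ
    have := hmono (hlog ρ hρ) (hlog σ hσ) (Real.log_le_log (by linarith [hρ.1]) hρσ)
    simpa only [hmean, hexp ρ hρ, hexp σ hσ] using this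
  · intro ρ hρ
    have := hS.cosh_sq_le_mean_sq hlim hge
      (fun t ht => hS.one_le_mean_area hgt hun hJ hdense ht) (hlog ρ hρ)
      ((hlog ρ hρ).2.le.trans hmod)
    rw [hmean, hexp ρ hρ, Real.cosh_eq, Real.exp_neg, hexp ρ hρ] at this
    convert this using 2
    ring

end IsHarmonicHomeo

theorem mainTheorem2 (R : ℝ) (hR : 1 < R) (hmod : Real.log R ≤ 3 / 2)
    (D : Set ℂ) (hD : IsHalfRoundAnnulus D) (h : ℂ → ℂ) (hh : IsHarmonicHomeo R D h) :
    ∃ L : ENNReal, HasMeanOuterRadius R h L ∧ ENNReal.ofReal (1 / 2 * (R + 1 / R)) ≤ L := by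
  obtain ⟨hmono, hbound⟩ := hh.circleAverage_bounds hR hmod hD
  -- In `[0, ∞]` a monotone function always converges to its supremum, so existence of the limit
  -- needs no boundedness.
  have hlim := MonotoneOn.tendsto_nhdsWithin_Ioo_left (nonempty_Ioo.2 hR)
    (f := fun ρ : ℝ => ENNReal.ofReal (Real.sqrt (Real.circleAverage (fun z => ‖h z‖ ^ 2) 0 ρ)))
    (fun ρ hρ σ hσ hρσ => ENNReal.ofReal_le_ofReal (Real.sqrt_le_sqrt (hmono hρ hσ hρσ)))
    (OrderTop.bddAbove _)
  refine ⟨_, hlim, ?_⟩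
  have hR0 : R ≠ 0 := by linarith
  have hc : Tendsto (fun ρ : ℝ => ENNReal.ofReal (1 / 2 * (ρ + 1 / ρ))) (𝓝[<] R)
      (𝓝 (ENNReal.ofReal (1 / 2 * (R + 1 / R)))) := by
    have : ContinuousAt (fun ρ : ℝ => 1 / 2 * (ρ + 1 / ρ)) R := by fun_prop (disch := assumption)
    exact ENNReal.tendsto_ofReal (this.tendsto.mono_left nhdsWithin_le_nhds)
  refine le_of_tendsto_of_tendsto hc hlim ?_
  filter_upwards [Ioo_mem_nhdsLT hR] with ρ hρ
  exact ENNReal.ofReal_le_ofReal (Real.le_sqrt_of_sq_le (hbound ρ hρ))
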